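/- Let $n\ge 3$ and $k\ge 0$ be integers. Let $\mathfrak g=\mathfrak{sp}_{2n}(\mathbb C)$ (type $\mathsf C_n$), with weight lattice $P=\mathbb Z\varepsilon_1\oplus\cdots\oplus\mathbb Z\varepsilon_n$ and positive roots $\varepsilon_i\pm\varepsilon_j$ ($1\le i<j\le n$) and $2\varepsilon_i$ ($1\le i\le n$). Put $\mathbf I_n=\{-n,\dots,-1,1,\dots,n\}$ and $\varepsilon_{-a}=-\varepsilon_a$. In the field of fractions of the group algebra $\mathbb C(q)[P]$, spanned over $\mathbb C(q)$ by the formal exponentials $e^{\mu}$ ($\mu\in P$), let $x_a=e^{\varepsilon_a}$ for $a\in\mathbf I_n$ and \[ \mathbf{Ch}\,G_{n,k}=\sum_{a\in\mathbf I_n}\frac{q^2x_a-q^{-2}x_a^{-1}}{x_a-x_a^{-1}}\;x_a^{k}\prod_{b\in\mathbf I_n\setminus\{\pm a\}}\frac{q x_a-q^{-1}x_b}{x_a-x_b}. \] For $0\le r\le 2n$ put $\bar r=\min\{r,\,2n-r,\,n-1\}$, \[ \lambda_k^r=(k-r)\varepsilon_1+\varepsilon_2+\cdots+\varepsilon_{\bar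 r+1},\qquad \tau_r=\begin{cases}1,&0\le r\le n-1,\\ 0,&r=n,\\ -1,&n+1\le r\le 2n,\end{cases} \] and, for a dominant weight $\lambda$, let $\chi(\lambda)=\sum_{\mu}\dim L(\lambda)_\mu\,e^{\mu}$ be the character of the finite-dimensional simple $\mathfrak g$-module $L(\lambda)$ of highest weight $\lambda$ (the weight $\lambda_k^r$ is dominant whenever $r\le k-1$). Then \[ \mathbf{Ch}\,G_{n,k}= \begin{cases} \displaystyle\sum_{r=0}^{n-1}q^{2n-2r}+\sum_{r=n+1}^{2n}q^{2n-2r}, & \text{if } k=0,\\[2ex] \displaystyle -q^{-k}+\sum_{r=0}^{k-1}(-1)^r\tau_r\,q^{2n-2r}\chi(\lambda_k^r), & \text{if } 1\le k\le 2n \text{ and } k \text{ is even},\\[2ex] \displaystyle \sum_{r=0}^{\min\{k-1,2n\}}(-1)^r\tau_r\,q^{2n-2r}\chi(\lambda_k^r), & \text{otherwise.} \end{cases} \] -/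

import Mathlib

namespace TypeC

noncomputable section

attribute [local instance] LieRing.ofAssociativeRing

/-! ### Weights and positive roots of type `C_n`

The weight lattice is `ℤε₁ ⊕ ⋯ ⊕ ℤεₙ`; a weight is its vector of coordinates. The basis
vector `ε_{i+1}` of the usual numbering is the one at the index `i : Fin n`. -/

/-- The weight lattice of type `C_n`. -/
abbrev Weight (n : ℕ) : Type := Fin n → ℤ

/-- The basis weight `ε_i`. -/
def eps {n : ℕ} (i : Fin n) : Weight n := Pi.single i 1

/-- The positive roots `ε_i ± ε_j` (`i < j`) and `2ε_i`. -/
def positiveRoots (n : ℕ) : Set (Weight n) :=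
  {α | (∃ i j : Fin n, i < j ∧ (α = eps i - eps j ∨ α = eps i + eps j)) ∨
    ∃ i : Fin n, α = 2 • eps i}

/-- The value `μ(h) = ∑ μ_i h_i` of a weight at the Cartan element with coordinates `h`. -/
def evalWeight {n : ℕ} (μ : Weight n) (h : Fin n → ℂ) : ℂ := ∑ i, (μ i : ℂ) * h i

/-! ### Simple modules of `𝔰𝔭_{2n}(ℂ)` and their characters -/

/-- The simple Lie algebra `𝔰𝔭_{2n}(ℂ)`. -/
abbrev Sp (n : ℕ) : LieSubalgebra ℂ (Matrix (Fin n ⊕ Fin n) (Fin n ⊕ Fin n) ℂ) :=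
  LieAlgebra.Symplectic.sp (Fin n) ℂ

/-- The element `diag(h₁, …, hₙ, -h₁, …, -hₙ)` of the diagonal Cartan subalgebra. -/
def cartan {n : ℕ} (h : Fin n → ℂ) : Sp n :=
  ⟨Matrix.fromBlocks (Matrix.diagonal h) 0 0 (-Matrix.diagonal h), by
    rw [Sp, LieAlgebra.Symplectic.sp, mem_skewAdjointMatricesLieSubalgebra,
      mem_skewAdjointMatricesSubmodule]
    simp only [Matrix.IsSkewAdjoint, Matrix.IsAdjointPair, Matrix.J, Matrix.fromBlocks_transpose,
      Matrix.fromBlocks_multiply, Matrix.fromBlocks_neg]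
    congr 1 <;> simp⟩

section Modules

variable {n : ℕ} (V : Type) [AddCommGroup V] [Module ℂ V] [LieRingModule (Sp n) V]
  [LieModule ℂ (Sp n) V]

/-- The weight space `V_μ`. -/
def weightSpace (μ : Weight n) : Submodule ℂ V :=
  ⨅ h : Fin n → ℂ,
    Module.End.eigenspace (LieModule.toEnd ℂ (Sp n) V (cartan h)) (evalWeight μ h)

/-- `v` is a highest weight vector of weight `lam`: a nonzero vector of weight `lam` that is
annihilated by every root vector of a positive root. -/
def IsHighestWeightVector (lam : Weight n) (v : V) : Prop :=
  v ≠ 0 ∧ v ∈ weightSpace V lam ∧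
    ∀ α ∈ positiveRoots n, ∀ x : Sp n,
      (∀ h : Fin n → ℂ, ⁅cartan h, x⁆ = evalWeight α h • x) → ⁅x, v⁆ = 0

end Modules

/-- A finite-dimensional simple `𝔰𝔭_{2n}(ℂ)`-module of highest weight `lam`. -/
structure SimpleModuleOfHighestWeight (n : ℕ) (lam : Weight n) where
  /-- The underlying space. -/
  carrier : Type
  [addCommGroup : AddCommGroup carrier]
  [module : Module ℂ carrier]
  [lieRingModule : LieRingModule (Sp n) carrier]
  [lieModule : LieModule ℂ (Sp n) carrier]
  finiteDimensional : FiniteDimensional ℂ carrier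
  irreducible : LieModule.IsIrreducible ℂ (Sp n) carrier
  exists_highestWeightVector : ∃ v : carrier, IsHighestWeightVector carrier lam v

attribute [instance] SimpleModuleOfHighestWeight.addCommGroup
attribute [instance] SimpleModuleOfHighestWeight.module
attribute [instance] SimpleModuleOfHighestWeight.lieRingModule
attribute [instance] SimpleModuleOfHighestWeight.lieModule

/-! ### The ring in which the characters live -/

/-- The ground field `ℂ(q)`. -/
abbrev K : Type := RatFunc ℂ

/-- The group algebra over `ℂ(q)` of the weight lattice, spanned by the formal exponentials. -/
abbrev GroupAlg (n : ℕ) : Type := AddMonoidAlgebra K (Weight n)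

/-- The field of fractions of the group algebra of the weight lattice. -/
abbrev Frac (n : ℕ) : Type := FractionRing (GroupAlg n)

/-- The formal exponential `e^μ`. -/
def expo {n : ℕ} (μ : Weight n) : Frac n :=
  algebraMap (GroupAlg n) (Frac n) (AddMonoidAlgebra.single μ 1)

/-- The indeterminate `q`, as an element of the field of fractions. -/
def q (n : ℕ) : Frac n :=
  algebraMap (GroupAlg n) (Frac n) (algebraMap K (GroupAlg n) RatFunc.X)

/-- The character `∑ μ, dim(V_μ) e^μ` of a module; the sum is finite when `V` is
finite-dimensional. -/
def character {n : ℕ} (V : Type) [AddCommGroup V] [Module ℂ V] [LieRingModule (Sp n) V]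
    [LieModule ℂ (Sp n) V] : Frac n :=
  ∑ᶠ μ : Weight n, (Module.finrank ℂ (weightSpace V μ) : Frac n) * expo μ

open Classical in
/-- `χ(lam)`, the character of the finite-dimensional simple module `L(lam)` of highest weight
`lam`, which is unique up to isomorphism (and `0` if there is none, that is, if `lam` is not
dominant). -/
def chi {n : ℕ} (lam : Weight n) : Frac n :=
  if h : Nonempty (SimpleModuleOfHighestWeight n lam) then character h.some.carrier else 0

/-! ### The element `G_{n,k}` and its image -/

/-- The index set `{-n, …, -1, 1, …, n}`: the pair `(i, s)` stands for the index `± (i + 1)`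
whose sign is `s`. -/
abbrev Idx (n : ℕ) : Type := Fin n × ℤˣ

/-- The index `-a`. -/
def Idx.opp {n : ℕ} (a : Idx n) : Idx n := (a.1, -a.2)

/-- The weight `ε_a`, with `ε_{-a} = -ε_a`. -/
def epsIdx {n : ℕ} (a : Idx n) : Weight n := (a.2 : ℤ) • eps a.1

/-- `P_{n,a} = ∏_{b ≠ ± a} (q L_a - q⁻¹ L_b) / (L_a - L_b)`. -/
def P {F : Type} [Field F] (n : ℕ) (q : F) (L : Idx n → F) (a : Idx n) : F :=
  ∏ b ∈ Finset.univ \ {a, a.opp}, (q * L a - q⁻¹ * L b) / (L a - L b)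

/-- `G_{n,k} = ∑_a (q² L_a - q⁻² L_a⁻¹) / (L_a - L_a⁻¹) · L_a^k · P_{n,a}`, as an expression
in `q` and in the `L_a`. -/
def G {F : Type} [Field F] (n k : ℕ) (q : F) (L : Idx n → F) : F :=
  ∑ a : Idx n,
    (q ^ 2 * L a - (q ^ 2)⁻¹ * (L a)⁻¹) / (L a - (L a)⁻¹) * L a ^ k * P n q L a

/-- `Ch G_{n,k}`: the expression `G_{n,k}` with each `L_a` replaced by `e^{ε_a}`. -/
def ChG (n k : ℕ) : Frac n := G n k (q n) fun a => expo (epsIdx a)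

/-! ### The hook weights and the signs -/

/-- `r̄ = min {r, 2n - r, n - 1}` for `0 ≤ r ≤ 2n`. -/
def rbar (n r : ℕ) : ℕ := min r (min (2 * n - r) (n - 1))

/-- `λ_k^r = (k - r) ε₁ + ε₂ + ⋯ + ε_{r̄ + 1}`. -/
def hookWeight (n k r : ℕ) : Weight n := fun i =>
  if (i : ℕ) = 0 then (k : ℤ) - r else if (i : ℕ) ≤ rbar n r then 1 else 0

/-- The sign `τ_r`: `1` for `r ≤ n - 1`, `0` for `r = n`, and `-1` for `n + 1 ≤ r`. -/
def tau (n r : ℕ) : ℤ := if r < n then 1 else if r = n then 0 else -1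

/-- The summand `(-1)^r τ_r q^{2n - 2r} χ(λ_k^r)`. -/
def hookTerm (n k r : ℕ) : Frac n :=
  (-1) ^ r * (tau n r : Frac n) * q n ^ (2 * (n : ℤ) - 2 * (r : ℤ)) * chi (hookWeight n k r)

end

end TypeC

/-! Write `D` for the Weyl denominator and `A(ν)` for the alternant, the determinant of the matrix
`x_i ^ ν_j - x_i ^ (-ν_j)`; then `D = A(ρ)`. As a function of one variable `x_i`, `D` is a constant
times `(x_i - x_i⁻¹) ∏ (x_i + x_i⁻¹ - x_j - x_j⁻¹)`. Hence the rational coefficient of `x_a ^ k` in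
`G_{n,k}` is exactly the quotient of `D`, with `x_a` replaced by `q² x_a`, by `D` itself. So `D ·
G_{n,k}` is a sum over `i` of determinants in which row `i` of the matrix of `A(ρ)` is replaced. A
sum of row replacements equals the corresponding sum of column replacements, and this gives
(`weylDenom_mul_G`) `D · G_{n,k} = ∑_j (q^{2ρ_j} A(ρ + kε_j) + q^{-2ρ_j} A(ρ - kε_j))`.

For `k ≥ 1`, each alternant on the right is straightened by permuting columns and changing signs. It
vanishes when two entries agree up to sign or one is zero; it equals `-A(ρ)` when `k = 2ρ_j`, which
is the source of the term `-q^{-k}`; otherwise it is `± A(λ_k^r + ρ)`. The Weyl character formula `D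
· χ(λ) = A(λ + ρ)` then turns alternants into characters. For `k = 0` every alternant is `D`.

The character formula is proved with the Casimir operator (`denomAlg_mul_charAlg_eq`). Traces on
weight spaces turn the Casimir eigenvalue equation into a differential equation for the character,
which says that `D · ch` is an eigenvector of the Laplacian `e^μ ↦ (μ, μ) e^μ`. Thus the exponents
of `D · ch` lie on one sphere. Weyl invariance of the multiplicities, which comes from `𝔰𝔩₂` theory,
gives `D · ch = ∑ mult(μ) A(μ + ρ)`, and only `μ = λ` contributes on the sphere through `λ + ρ`.

Since `chi` is `0` in the absence of a simple module, existence is needed too. A power of a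
coordinate times a generic minor is a highest weight vector of hook weight in a polynomial module,
and a simple subquotient is extracted from it. -/

namespace TypeC

noncomputable section

attribute [local instance] LieRing.ofAssociativeRing

/-! ### Alternants and the Weyl denominator of type `C_n` -/

section Alternant

variable {F : Type*} [Field F] {n : ℕ}

/-- The odd Laurent monomial `x ^ m - x ^ (-m)`. -/
def oddPow (x : F) (m : ℤ) : F := x ^ m - x ^ (-m)

@[simp] lemma oddPow_zero (x : F) : oddPow x 0 = 0 := by simp [oddPow]

@[simp] lemma oddPow_neg (x : F) (m : ℤ) : oddPow x (-m) = -oddPow x m := by simp [oddPow]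

lemma oddPow_one (x : F) : oddPow x 1 = x - x⁻¹ := by simp [oddPow]

/-- The matrix with entries `x_i ^ ν_j - x_i ^ (-ν_j)`. -/
def altMatrix (x : Fin n → F) (ν : Weight n) : Matrix (Fin n) (Fin n) F :=
  Matrix.of fun i j => oddPow (x i) (ν j)

/-- The alternant `∑ w, sgn w · x ^ (w ν)` over the Weyl group of type `C_n`, as a determinant. -/
def alternant (x : Fin n → F) (ν : Weight n) : F := (altMatrix x ν).det

/-- The half sum of the positive roots. -/
def rho (n : ℕ) : Weight n := fun j => (n : ℤ) - j

/-- The Weyl denominator of type `C_n`. -/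
def weylDenom (x : Fin n → F) : F :=
  (∏ i, (x i - (x i)⁻¹)) *
    ∏ i, ∏ j ∈ Finset.Ioi i, (x i + (x i)⁻¹ - (x j + (x j)⁻¹))

open Polynomial in
/-- `x ^ (m + 1) - x ^ (-(m + 1))` is `x - x⁻¹` times a monic polynomial in `x + x⁻¹`. -/
lemma exists_monic_oddPow (F : Type*) [Field F] (m : ℕ) : ∃ p : F[X], p.natDegree = m ∧ p.Monic ∧
    ∀ x : F, x ≠ 0 → oddPow x (m + 1) = oddPow x 1 * p.eval (x + x⁻¹) := by
  induction m using Nat.strong_induction_on with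
  | _ m ih =>
    rcases m with _ | _ | m
    · exact ⟨1, by simp, monic_one, by simp⟩
    · refine ⟨X, by simp, monic_X, fun x hx => ?_⟩
      simp only [oddPow, eval_X]
      norm_num
      field_simp
      ring
    · obtain ⟨p, hpd, hpm, hp⟩ := ih m (by lia)
      obtain ⟨r, hrd, hrm, hr⟩ := ih (m + 1) (by lia)
      have hXr : (X * r).Monic := monic_X.mul hrm
      have hd : (X * r).natDegree = m + 2 := by
        rw [monic_X.natDegree_mul hrm, hrd, natDegree_X]; ring
      have hlt : p.degree < (X * r).degree := by
        rw [degree_eq_natDegree hpm.ne_zero, degree_eq_natDegree hXr.ne_zero, hpd, hd]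
        exact_mod_cast (by lia : m < m + 2)
      -- The Chebyshev recursion: `oddPow x (m + 3) = (x + x⁻¹) * oddPow x (m + 2) - oddPow x (m +
      -- 1)`.
      refine ⟨X * r - p, ?_, hXr.sub_of_left hlt, fun x hx => ?_⟩
      · rw [natDegree_sub_eq_left_of_natDegree_lt (by lia), hd]
      · have h1 := hp x hx
        have h2 := hr x hx
        rw [eval_sub, eval_mul, eval_X, mul_sub, ← h1, mul_left_comm, ← h2]
        simp only [oddPow]
        push_cast
        have e1 : x ^ (-((m : ℤ) + 1 + 1)) = x⁻¹ * x⁻¹ * x ^ (-(m : ℤ)) := by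
          rw [← zpow_neg_one, ← zpow_add₀ hx, ← zpow_add₀ hx]; congr 1; ring
        have e2 : x ^ (-((m : ℤ) + 1 + 1 + 1)) = x⁻¹ * x⁻¹ * x⁻¹ * x ^ (-(m : ℤ)) := by
          rw [← zpow_neg_one, ← zpow_add₀ hx, ← zpow_add₀ hx, ← zpow_add₀ hx]; congr 1; ring
        have e3 : x ^ (-((m : ℤ) + 1)) = x⁻¹ * x ^ (-(m : ℤ)) := by
          rw [← zpow_neg_one, ← zpow_add₀ hx]; congr 1; ring
        rw [e1, e2, e3]
        simp only [zpow_add₀ hx, zpow_one]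
        field_simp
        ring

lemma prod_Ioi_rev (f : Fin n → Fin n → F) :
    ∏ i : Fin n, ∏ j ∈ Finset.Ioi i, f j.rev i.rev = ∏ i : Fin n, ∏ j ∈ Finset.Ioi i, f i j := by
  rw [Finset.prod_sigma', Finset.prod_sigma']
  refine Finset.prod_bij' (fun p _ => ⟨p.2.rev, p.1.rev⟩) (fun p _ => ⟨p.2.rev, p.1.rev⟩)
    ?_ ?_ ?_ ?_ ?_ <;> simp

/-- The Weyl denominator formula of type `C_n`. -/
theorem weylDenom_eq_alternant (x : Fin n → F) (hx : ∀ i, x i ≠ 0) :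
    weylDenom x = alternant x (rho n) := by
  choose p hpd hpm hp using exists_monic_oddPow F
  -- A Vandermonde determinant in `x + x⁻¹`. The indices are reversed because `rho` decreases from
  -- `n` to `1` while the polynomial degrees increase; the reversal also fixes the sign of each
  -- difference.
  have key := Matrix.det_eval_matrixOfPolynomials_eq_det_vandermonde
    (fun i : Fin n => x i.rev + (x i.rev)⁻¹) (fun j => p j) (fun j => hpd j) (fun j => hpm j)
  rw [Matrix.det_vandermonde,
    prod_Ioi_rev fun i j => x i + (x i)⁻¹ - (x j + (x j)⁻¹)] at key
  rw [weylDenom, key, alternant, ← Matrix.det_submatrix_equiv_self Fin.revPerm (altMatrix x _),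
    ← Equiv.prod_comp Fin.revPerm, ← Matrix.det_mul_column]
  congr 1
  ext i j
  have hj : rho n j.rev = ((j : ℕ) : ℤ) + 1 := by
    simp only [rho, Fin.val_rev]; have := j.2; lia
  simp only [Matrix.of_apply, altMatrix, Matrix.submatrix_apply, Fin.revPerm_apply, hj,
    hp j _ (hx _), oddPow_one]

/-- `R` collects the factors without index `i` and all the signs. It cancels in every quotient, so
only its independence of `t` matters. -/
lemma prod_Ioi_update (u : Fin n → F) (i : Fin n) : ∃ R : F, ∀ t,
    ∏ a, ∏ b ∈ Finset.Ioi a, (Function.update u i t a - Function.update u i t b) =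
      R * ∏ j ∈ Finset.univ.erase i, (t - u j) := by
  refine ⟨(∏ a ∈ Finset.Iio i, (-1)) * ∏ a ∈ Finset.univ.erase i,
    ∏ b ∈ (Finset.Ioi a).erase i, (u a - u b), fun t => ?_⟩
  rw [← Finset.mul_prod_erase _ _ (Finset.mem_univ i)]
  have h1 : ∏ b ∈ Finset.Ioi i, (Function.update u i t i - Function.update u i t b) =
      ∏ b ∈ Finset.Ioi i, (t - u b) := by
    refine Finset.prod_congr rfl fun b hb => ?_
    rw [Function.update_self, Function.update_of_ne (Finset.mem_Ioi.1 hb).ne']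
  have h2 : ∀ a ∈ Finset.univ.erase i,
      ∏ b ∈ Finset.Ioi a, (Function.update u i t a - Function.update u i t b) =
        (if a < i then -1 * (t - u a) else 1) * ∏ b ∈ (Finset.Ioi a).erase i, (u a - u b) := by
    intro a ha
    have hai := Finset.ne_of_mem_erase ha
    have h3 : ∏ b ∈ (Finset.Ioi a).erase i, (u a - u b) =
        ∏ b ∈ (Finset.Ioi a).erase i, (Function.update u i t a - Function.update u i t b) := by
      refine Finset.prod_congr rfl fun b hb => ?_
      rw [Function.update_of_ne (Finset.ne_of_mem_erase hb), Function.update_of_ne hai]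
    split_ifs with h
    · rw [h3, ← Finset.mul_prod_erase _ _ (Finset.mem_Ioi.2 h), Function.update_self,
        Function.update_of_ne hai]
      ring
    · rw [h3, Finset.erase_eq_of_notMem (by simpa using h), one_mul]
  rw [h1, Finset.prod_congr rfl h2, Finset.prod_mul_distrib, ← Finset.prod_filter]
  have h4 : (Finset.univ.erase i).filter (· < i) = Finset.Iio i := by
    ext a; simp; exact fun h => h.ne
  have h5 : Finset.univ.erase i = Finset.Ioi i ∪ Finset.Iio i := by
    ext a; simp [lt_or_lt_iff_ne]; tauto
  have h6 : ∏ j ∈ Finset.univ.erase i, (t - u j) =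
      (∏ j ∈ Finset.Ioi i, (t - u j)) * ∏ j ∈ Finset.Iio i, (t - u j) := by
    rw [h5, Finset.prod_union]
    exact Finset.disjoint_left.2 fun a h h' =>
      lt_asymm (Finset.mem_Ioi.1 h) (Finset.mem_Iio.1 h')
  rw [h4, h6, Finset.prod_mul_distrib]
  ring

lemma weylDenom_update (x : Fin n → F) (i : Fin n) : ∃ R : F, ∀ t,
    weylDenom (Function.update x i t) =
      R * ((t - t⁻¹) * ∏ j ∈ Finset.univ.erase i, (t + t⁻¹ - (x j + (x j)⁻¹))) := by
  obtain ⟨R, hR⟩ := prod_Ioi_update (fun j => x j + (x j)⁻¹) i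
  refine ⟨(∏ j ∈ Finset.univ.erase i, (x j - (x j)⁻¹)) * R, fun t => ?_⟩
  have h := hR (t + t⁻¹)
  have hu : ∀ a, Function.update (fun j => x j + (x j)⁻¹) i (t + t⁻¹) a =
      Function.update x i t a + (Function.update x i t a)⁻¹ := by
    intro a
    rcases eq_or_ne a i with rfl | ha
    · simp
    · simp [ha]
  simp only [hu] at h
  have h1 : ∏ a, (Function.update x i t a - (Function.update x i t a)⁻¹) =
      (t - t⁻¹) * ∏ j ∈ Finset.univ.erase i, (x j - (x j)⁻¹) := by
    rw [← Finset.mul_prod_erase _ _ (Finset.mem_univ i), Function.update_self]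
    congr 1
    exact Finset.prod_congr rfl fun j hj => by
      rw [Function.update_of_ne (Finset.ne_of_mem_erase hj)]
  rw [weylDenom, h, h1]
  ring

/-- In the single variable `t`, the factor `t - t⁻¹` is odd under inversion and all the others
depend on `t + t⁻¹` only. -/
lemma weylDenom_update_inv (x : Fin n → F) (i : Fin n) (t : F) :
    weylDenom (Function.update x i t⁻¹) = -weylDenom (Function.update x i t) := by
  obtain ⟨R, hR⟩ := weylDenom_update x i
  rw [hR, hR, inv_inv, add_comm t⁻¹ t]
  ring

end Alternant

/-! ### The element `G_{n,k}` times the Weyl denominator -/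

section GSum

variable {F : Type} [Field F] {n : ℕ}

/-- The variable `x_a` of the signed index `a`. -/
def signedVar (x : Fin n → F) (a : Idx n) : F := x a.1 ^ (a.2 : ℤ)

lemma prod_sdiff_opp (f : Idx n → F) (a : Idx n) :
    ∏ b ∈ Finset.univ \ {a, a.opp}, f b =
      ∏ j ∈ Finset.univ.erase a.1, f (j, 1) * f (j, -1) := by
  have h : (Finset.univ \ {a, a.opp} : Finset (Idx n)) =
      Finset.univ.erase a.1 ×ˢ (Finset.univ : Finset ℤˣ) := by
    obtain ⟨i, s⟩ := a
    ext ⟨j, t⟩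
    rcases Int.units_eq_one_or s with rfl | rfl <;> rcases Int.units_eq_one_or t with rfl | rfl <;>
      simp [Idx.opp]
  rw [h, Finset.prod_product]
  refine Finset.prod_congr rfl fun j _ => ?_
  rw [UnitsInt.univ, Finset.prod_pair (by decide)]

/-- The factors of `P` for `b = j` and `b = -j` multiply to an expression in `y + y⁻¹` below and in
`q² y + (q² y)⁻¹` above. The right side is the quotient of the `t`-dependent part in
`weylDenom_update` at `t = q² y` by the one at `t = y`. -/
lemma factor_mul_P (x : Fin n → F) (hx : ∀ i, x i ≠ 0) (q : F) (hq : q ≠ 0) (a : Idx n) (y : F)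
    (hy : signedVar x a = y) (hy0 : y ≠ 0) :
    (q ^ 2 * y - (q ^ 2)⁻¹ * y⁻¹) / (y - y⁻¹) * P n q (signedVar x) a =
      ((q ^ 2 * y - (q ^ 2 * y)⁻¹) * ∏ j ∈ Finset.univ.erase a.1,
          (q ^ 2 * y + (q ^ 2 * y)⁻¹ - (x j + (x j)⁻¹))) /
        ((y - y⁻¹) * ∏ j ∈ Finset.univ.erase a.1, (y + y⁻¹ - (x j + (x j)⁻¹))) := by
  rw [P, prod_sdiff_opp, mul_inv, mul_div_mul_comm, ← Finset.prod_div_distrib]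
  congr 1
  refine Finset.prod_congr rfl fun j _ => ?_
  have hj := hx j
  rw [hy, div_mul_div_comm]
  have h1 : (q * y - q⁻¹ * signedVar x (j, 1)) * (q * y - q⁻¹ * signedVar x (j, -1)) =
      y * (q ^ 2 * y + (q ^ 2)⁻¹ * y⁻¹ - (x j + (x j)⁻¹)) := by
    simp only [signedVar, Units.val_one, zpow_one, Units.val_neg, zpow_neg]
    field_simp
    ring
  have h2 : (y - signedVar x (j, 1)) * (y - signedVar x (j, -1)) =
      y * (y + y⁻¹ - (x j + (x j)⁻¹)) := by
    simp only [signedVar, Units.val_one, zpow_one, Units.val_neg, zpow_neg]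
    field_simp
    ring
  rw [h1, h2, mul_div_mul_left _ _ hy0]

lemma weylDenom_mul_pos (x : Fin n → F) (hx : ∀ i, x i ≠ 0) (hD : weylDenom x ≠ 0) (q : F)
    (hq : q ≠ 0) (i : Fin n) :
    weylDenom x * ((q ^ 2 * x i - (q ^ 2)⁻¹ * (x i)⁻¹) / (x i - (x i)⁻¹) *
      P n q (signedVar x) (i, 1)) = weylDenom (Function.update x i (q ^ 2 * x i)) := by
  obtain ⟨R, hR⟩ := weylDenom_update x i
  rw [factor_mul_P x hx q hq (i, 1) (x i) (by simp [signedVar]) (hx i), hR (q ^ 2 * x i)]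
  have h := hR (x i)
  rw [Function.update_eq_self] at h
  have h0 := hD
  rw [h] at h0
  rw [h]
  generalize (x i - (x i)⁻¹) * ∏ j ∈ Finset.univ.erase i, (x i + (x i)⁻¹ - (x j + (x j)⁻¹)) = A at *
  rw [mul_assoc, mul_div_cancel₀ _ (right_ne_zero_of_mul h0)]

/-- Here the value `y = x_i⁻¹` is scaled by `q²`. Passing from `x_i` to its inverse changes the sign
of both denominators, and the two signs cancel. -/
lemma weylDenom_mul_neg (x : Fin n → F) (hx : ∀ i, x i ≠ 0) (hD : weylDenom x ≠ 0) (q : F)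
    (hq : q ≠ 0) (i : Fin n) :
    weylDenom x * ((q ^ 2 * (x i)⁻¹ - (q ^ 2)⁻¹ * (x i)⁻¹⁻¹) / ((x i)⁻¹ - (x i)⁻¹⁻¹) *
      P n q (signedVar x) (i, -1)) = weylDenom (Function.update x i ((q ^ 2)⁻¹ * x i)) := by
  obtain ⟨R, hR⟩ := weylDenom_update x i
  have e : (q ^ 2)⁻¹ * x i = (q ^ 2 * (x i)⁻¹)⁻¹ := by rw [mul_inv, inv_inv]
  rw [factor_mul_P x hx q hq (i, -1) (x i)⁻¹ (by simp [signedVar]) (inv_ne_zero (hx i)), e,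
    weylDenom_update_inv, hR (q ^ 2 * (x i)⁻¹)]
  have h := weylDenom_update_inv x i (x i)
  rw [Function.update_eq_self, hR] at h
  have h' : weylDenom x = -(R * (((x i)⁻¹ - (x i)⁻¹⁻¹) *
    ∏ j ∈ Finset.univ.erase i, ((x i)⁻¹ + (x i)⁻¹⁻¹ - (x j + (x j)⁻¹)))) := by rw [h, neg_neg]
  have h0 := hD
  rw [h', neg_ne_zero] at h0
  rw [h']
  generalize ((x i)⁻¹ - (x i)⁻¹⁻¹) *
    ∏ j ∈ Finset.univ.erase i, ((x i)⁻¹ + (x i)⁻¹⁻¹ - (x j + (x j)⁻¹)) = A at *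
  rw [neg_mul, mul_assoc, mul_div_cancel₀ _ (right_ne_zero_of_mul h0)]

lemma alternant_update_left (x : Fin n → F) (ν : Weight n) (i : Fin n) (t : F) :
    alternant (Function.update x i t) ν =
      ((altMatrix x ν).updateRow i fun j => oddPow t (ν j)).det := by
  rw [alternant]
  congr 1
  ext a b
  rcases eq_or_ne a i with rfl | h
  · simp [altMatrix]
  · simp [altMatrix, h]

lemma alternant_update_right (x : Fin n → F) (ν : Weight n) (j : Fin n) (m : ℤ) :
    alternant x (Function.update ν j m) =
      ((altMatrix x ν).updateCol j fun i => oddPow (x i) m).det := by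
  rw [alternant]
  congr 1
  ext a b
  rcases eq_or_ne b j with rfl | h
  · simp [altMatrix]
  · simp [altMatrix, h]

/-- By Laplace expansion both sides are the trace of `A.adjugate * B`. -/
lemma sum_det_updateRow_eq_sum_det_updateCol {m R : Type*} [Fintype m] [DecidableEq m]
    [CommRing R] (A B : Matrix m m R) :
    ∑ i, (A.updateRow i (B i)).det = ∑ j, (A.updateCol j fun i => B i j).det := by
  have h1 : ∀ i, (A.updateRow i (B i)).det = ∑ j, A.adjugate j i * B i j := by
    intro i
    rw [← Matrix.cramer_transpose_apply, Matrix.cramer_eq_adjugate_mulVec,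
      ← Matrix.adjugate_transpose]
    rfl
  have h2 : ∀ j, (A.updateCol j fun i => B i j).det = ∑ i, A.adjugate j i * B i j := by
    intro j
    rw [← Matrix.cramer_apply, Matrix.cramer_eq_adjugate_mulVec]
    rfl
  simp only [h1, h2]
  exact Finset.sum_comm

/-- The product of `G_{n,k}` with the Weyl denominator, as a combination of alternants. -/
theorem weylDenom_mul_G (x : Fin n → F) (hx : ∀ i, x i ≠ 0) (hD : weylDenom x ≠ 0) (q : F)
    (hq : q ≠ 0) (k : ℕ) :
    weylDenom x * G n k q (signedVar x) =
      ∑ j, (q ^ (2 * rho n j) * alternant x (Function.update (rho n) j (rho n j + k)) +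
        q ^ (-(2 * rho n j)) * alternant x (Function.update (rho n) j (rho n j - k))) := by
  have hq2 : q ^ 2 ≠ 0 := pow_ne_zero _ hq
  let B : Matrix (Fin n) (Fin n) F := Matrix.of fun i j =>
    q ^ (2 * rho n j) * oddPow (x i) (rho n j + k) +
      q ^ (-(2 * rho n j)) * oddPow (x i) (rho n j - k)
  have hrow : ∀ i, weylDenom x * ∑ s : ℤˣ,
      (q ^ 2 * signedVar x (i, s) - (q ^ 2)⁻¹ * (signedVar x (i, s))⁻¹) /
        (signedVar x (i, s) - (signedVar x (i, s))⁻¹) * signedVar x (i, s) ^ k *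
          P n q (signedVar x) (i, s) = ((altMatrix x (rho n)).updateRow i (B i)).det := by
    intro i
    have hi := hx i
    have e1 : signedVar x (i, 1) = x i := by simp [signedVar]
    have e2 : signedVar x (i, -1) = (x i)⁻¹ := by simp [signedVar]
    have hup : ∀ t : F, t ≠ 0 → weylDenom (Function.update x i t) =
        ((altMatrix x (rho n)).updateRow i fun j => oddPow t (rho n j)).det := by
      intro t ht
      rw [weylDenom_eq_alternant, alternant_update_left]
      intro a
      rcases eq_or_ne a i with rfl | h
      · simpa using ht
      · simpa [h] using hx a
    -- The indices `i` and `-i` give four monomials in each column. They regroup into two odd ones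
    -- because the terms for `-i` are, up to sign, those for `i` with all exponents negated.
    have hB : B i = (x i ^ k • fun j => oddPow (q ^ 2 * x i) (rho n j)) +
        ((x i)⁻¹ ^ k • fun j => oddPow ((q ^ 2)⁻¹ * x i) (rho n j)) := by
      ext j
      simp only [B, Matrix.of_apply, Pi.add_apply, Pi.smul_apply, smul_eq_mul, oddPow, mul_zpow,
        inv_zpow, ← zpow_natCast, ← zpow_mul, ← zpow_neg, neg_sub, neg_add]
      have e3 : x i ^ (rho n j - k) = x i ^ (rho n j) * x i ^ (-k : ℤ) := by
        rw [← zpow_add₀ hi]; rfl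
      have e4 : x i ^ (k - rho n j) = x i ^ (-rho n j) * x i ^ (k : ℤ) := by
        rw [← zpow_add₀ hi]; congr 1; ring
      rw [e3, e4, zpow_add₀ hi, zpow_add₀ hi]
      push_cast
      simp only [mul_neg]
      ring_nf
    rw [UnitsInt.univ, Finset.sum_pair (by decide), e1, e2, mul_add, hB, Matrix.det_updateRow_add,
      Matrix.det_updateRow_smul, Matrix.det_updateRow_smul, ← hup _ (mul_ne_zero hq2 hi),
      ← hup _ (mul_ne_zero (inv_ne_zero hq2) hi), ← weylDenom_mul_pos x hx hD q hq i,
      ← weylDenom_mul_neg x hx hD q hq i]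
    ring
  rw [G, Fintype.sum_prod_type, Finset.mul_sum]
  simp only [hrow]
  rw [sum_det_updateRow_eq_sum_det_updateCol]
  refine Finset.sum_congr rfl fun j _ => ?_
  have hB : (fun i => B i j) = (q ^ (2 * rho n j) • fun i => oddPow (x i) (rho n j + k)) +
      (q ^ (-(2 * rho n j)) • fun i => oddPow (x i) (rho n j - k)) := by
    ext i; simp [B]
  rw [hB, Matrix.det_updateCol_add, Matrix.det_updateCol_smul, Matrix.det_updateCol_smul,
    ← alternant_update_right, ← alternant_update_right]

end GSum

/-! ### Straightening of the alternants of `ρ ± kε_j` -/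

section Straightening

variable {F : Type} [Field F] {n : ℕ}

lemma alternant_eq_zero_of_eq (x : Fin n → F) (ν : Weight n) {i j : Fin n} (hij : i ≠ j)
    (h : ν i = ν j) : alternant x ν = 0 :=
  Matrix.det_zero_of_column_eq hij fun a => by simp [altMatrix, h]

lemma alternant_eq_zero_of_zero (x : Fin n → F) (ν : Weight n) {j : Fin n} (h : ν j = 0) :
    alternant x ν = 0 :=
  Matrix.det_eq_zero_of_column_eq_zero j fun a => by simp [altMatrix, h]

lemma alternant_update_neg (x : Fin n → F) (ν : Weight n) (j : Fin n) (m : ℤ) :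
    alternant x (Function.update ν j (-m)) = -alternant x (Function.update ν j m) := by
  rw [alternant_update_right, alternant_update_right]
  have : (fun i => oddPow (x i) (-m)) = (-1 : F) • fun i => oddPow (x i) m := by
    ext i; simp
  rw [this, Matrix.det_updateCol_smul]
  ring

/-- Moving the new entry from position `j` to the front is a cycle of sign `(-1) ^ j`. The entries
it passes shift by one place, so relative to `rho` each of them gains `1`: these are the ones of the
hook. Only `rbar n r = j` is assumed, so that both `r = j` and `r = 2n - j` are covered. -/
lemma alternant_update_rho_eq_hook (x : Fin n → F) (j : Fin n) (k r : ℕ) (hr : rbar n r = j) :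
    alternant x (Function.update (rho n) j ((n : ℤ) + k - r)) =
      (-1) ^ (j : ℕ) * alternant x (hookWeight n k r + rho n) := by
  have : NeZero n := ⟨by have := j.2; lia⟩
  have key : Function.update (rho n) j ((n : ℤ) + k - r) =
      (hookWeight n k r + rho n) ∘ Fin.cycleRange j := by
    ext i
    simp only [Function.comp_apply, Pi.add_apply, hookWeight, rho, hr]
    rcases lt_trichotomy i j with h | rfl | h
    · have hv := Fin.coe_cycleRange_of_lt h
      have : (i : ℕ) < j := h
      rw [Function.update_of_ne h.ne, hv, if_neg (by lia), if_pos (by lia)]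
      simp only [rho]; push_cast; ring
    · rw [Function.update_self, Fin.cycleRange_self]
      simp; ring
    · have : (j : ℕ) < i := h
      rw [Function.update_of_ne h.ne', Fin.cycleRange_of_gt h, if_neg (by lia), if_neg (by lia)]
      simp [rho]
  rw [key, alternant, alternant]
  have : altMatrix x ((hookWeight n k r + rho n) ∘ Fin.cycleRange j) =
      (altMatrix x (hookWeight n k r + rho n)).submatrix id (Fin.cycleRange j) := rfl
  rw [this, Matrix.det_permute', Fin.sign_cycleRange]
  simp

lemma rbar_of_lt {r : ℕ} (h : r < n) : rbar n r = r := by simp only [rbar]; lia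

lemma rbar_two_mul_sub {j : ℕ} (h : j < n) : rbar n (2 * n - j) = j := by simp only [rbar]; lia

lemma alternant_rho_add_of_lt (x : Fin n → F) (j : Fin n) (k : ℕ) :
    alternant x (Function.update (rho n) j (rho n j + k)) =
      (-1) ^ (j : ℕ) * alternant x (hookWeight n k j + rho n) := by
  rw [← alternant_update_rho_eq_hook x j k j (rbar_of_lt j.2)]
  congr 2
  simp only [rho]; ring

/-- The new entry `ρ_j + k` is the entry of `rho` at position `j - k`. -/
lemma alternant_rho_add_of_le (x : Fin n → F) (j : Fin n) (k : ℕ) (hk : 1 ≤ k) (hkj : k ≤ j) :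
    alternant x (Function.update (rho n) j (rho n j + k)) = 0 := by
  have hj := j.2
  have hne : (⟨j - k, by lia⟩ : Fin n) ≠ j := by
    intro h; have := congrArg Fin.val h; simp at this; lia
  refine alternant_eq_zero_of_eq x _ hne ?_
  rw [Function.update_of_ne hne, Function.update_self]
  simp only [rho]
  lia

/-- Up to sign the new entry is `k - ρ_j = n + k - (2n - j)`, the leading entry for `r = 2n - j`. -/
lemma alternant_rho_sub_hook (x : Fin n → F) (j : Fin n) (k : ℕ) :
    alternant x (Function.update (rho n) j (rho n j - k)) =
      -((-1) ^ (j : ℕ) * alternant x (hookWeight n k (2 * n - j) + rho n)) := by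
  have hj := j.2
  rw [← alternant_update_rho_eq_hook x j k _ (rbar_two_mul_sub hj), ← alternant_update_neg]
  congr 2
  simp only [rho]; lia

/-- The bound `k ≤ 2n - j` puts `ρ_j - k` in `[-n, n]`, so it is zero or, up to sign, an entry of
`rho`. That entry sits at another position unless `ρ_j - k = -ρ_j`, which is excluded by `hne`. -/
lemma alternant_rho_sub_eq_zero (x : Fin n → F) (j : Fin n) (k : ℕ) (hk : 1 ≤ k)
    (hkj : k ≤ 2 * n - j) (hne : k ≠ 2 * (n - j)) :
    alternant x (Function.update (rho n) j (rho n j - k)) = 0 := by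
  have hj := j.2
  rcases lt_trichotomy (rho n j - k) 0 with h | h | h
  · have h' := h
    simp only [rho] at h'
    have hi : (⟨2 * n - k - j, by lia⟩ : Fin n) ≠ j := by
      intro h; have := congrArg Fin.val h; simp at this; lia
    rw [← neg_neg (rho n j - k), alternant_update_neg, neg_eq_zero]
    refine alternant_eq_zero_of_eq x _ hi ?_
    rw [Function.update_of_ne hi, Function.update_self]
    simp only [rho]
    lia
  · exact alternant_eq_zero_of_zero x _ (j := j) (by simpa using h)
  · simp only [rho] at h
    have hi : (⟨j + k, by lia⟩ : Fin n) ≠ j := by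
      intro h; have := congrArg Fin.val h; simp at this; lia
    refine alternant_eq_zero_of_eq x _ hi ?_
    rw [Function.update_of_ne hi, Function.update_self]
    simp only [rho]
    lia

lemma alternant_rho_sub_eq_neg (x : Fin n → F) (j : Fin n) (k : ℕ) (hk : k = 2 * (n - j)) :
    alternant x (Function.update (rho n) j (rho n j - k)) = -alternant x (rho n) := by
  have hj := j.2
  have : rho n j - k = -rho n j := by simp only [rho]; lia
  rw [this, alternant_update_neg, Function.update_eq_self]

end Straightening

/-! ### Root vectors of `𝔰𝔭_{2n}(ℂ)` -/

section RootVectors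

open Matrix

variable {n : ℕ}

/-- The weight `± ε_i` of a basis vector of `ℂ^{2n}`. -/
def wt (a : Fin n ⊕ Fin n) : Weight n := Sum.elim eps (fun i => -eps i) a

/-- The coordinate `± μ_i` of a weight at a signed index. -/
def coord (μ : Weight n) (a : Fin n ⊕ Fin n) : ℤ := Sum.elim μ (fun i => -μ i) a

lemma mem_sp_iff (A : Matrix (Fin n ⊕ Fin n) (Fin n ⊕ Fin n) ℂ) :
    A ∈ Sp n ↔ Aᵀ * J (Fin n) ℂ = -(J (Fin n) ℂ * A) := by
  rw [Sp, LieAlgebra.Symplectic.sp, mem_skewAdjointMatricesLieSubalgebra,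
    mem_skewAdjointMatricesSubmodule, Matrix.IsSkewAdjoint, Matrix.IsAdjointPair, mul_neg]

lemma J_mul_transpose (y : Sp n) :
    J (Fin n) ℂ * (y : Matrix (Fin n ⊕ Fin n) (Fin n ⊕ Fin n) ℂ)ᵀ = -(y.1 * J (Fin n) ℂ) := by
  have h := (mem_sp_iff _).1 y.2
  have h2 : J (Fin n) ℂ * (y.1ᵀ * J (Fin n) ℂ) * J (Fin n) ℂ =
      -(J (Fin n) ℂ * (J (Fin n) ℂ * y.1) * J (Fin n) ℂ) := by rw [h]; simp
  have hJ := J_squared (Fin n) ℂ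
  rw [← Matrix.mul_assoc, Matrix.mul_assoc _ _ (J (Fin n) ℂ), hJ, ← Matrix.mul_assoc, hJ] at h2
  rw [eq_neg_iff_add_eq_zero, add_comm, ← eq_neg_iff_add_eq_zero]
  simpa using h2.symm

/-- The equivariant projection `X ↦ X + J Xᵀ J` of `𝔤𝔩_{2n}` onto `𝔰𝔭_{2n}`; on `𝔰𝔭_{2n}` it is
multiplication by `2`. -/
def spProj : Matrix (Fin n ⊕ Fin n) (Fin n ⊕ Fin n) ℂ →ₗ[ℂ] Sp n where
  toFun X := ⟨X + J (Fin n) ℂ * Xᵀ * J (Fin n) ℂ, by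
    have hJ := J_squared (Fin n) ℂ
    rw [mem_sp_iff]
    simp only [transpose_add, transpose_mul, transpose_transpose, J_transpose, Matrix.add_mul,
      Matrix.mul_add, Matrix.neg_mul, Matrix.mul_neg, neg_neg]
    have e1 : J (Fin n) ℂ * (X * J (Fin n) ℂ) * J (Fin n) ℂ = -(J (Fin n) ℂ * X) := by
      rw [Matrix.mul_assoc, Matrix.mul_assoc, hJ]; simp
    have e2 : J (Fin n) ℂ * (J (Fin n) ℂ * Xᵀ * J (Fin n) ℂ) = -(Xᵀ * J (Fin n) ℂ) := by
      rw [← Matrix.mul_assoc, ← Matrix.mul_assoc, hJ]; simp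
    rw [e1, e2]
    abel⟩
  map_add' X Y := by ext1; simp [Matrix.mul_add, Matrix.add_mul]; abel
  map_smul' c X := by ext1; simp

lemma spProj_val (X : Matrix (Fin n ⊕ Fin n) (Fin n ⊕ Fin n) ℂ) :
    (spProj X : Matrix (Fin n ⊕ Fin n) (Fin n ⊕ Fin n) ℂ) =
      X + J (Fin n) ℂ * Xᵀ * J (Fin n) ℂ := rfl

/-- Brackets with images of matrix units thus reduce to products of matrix units, and no case
distinction over the roots is required. -/
lemma lie_spProj (y : Sp n) (X : Matrix (Fin n ⊕ Fin n) (Fin n ⊕ Fin n) ℂ) :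
    ⁅y, spProj X⁆ = spProj (y.1 * X - X * y.1) := by
  apply Subtype.ext
  rw [LieSubalgebra.coe_bracket, Ring.lie_def, spProj_val, spProj_val]
  have h1 := (mem_sp_iff _).1 y.2
  have h2 := J_mul_transpose y
  have e1 : J (Fin n) ℂ * (y.1 * X)ᵀ * J (Fin n) ℂ = -(J (Fin n) ℂ * Xᵀ * J (Fin n) ℂ * y.1) := by
    rw [transpose_mul, Matrix.mul_assoc, Matrix.mul_assoc, h1]
    simp [Matrix.mul_assoc]
  have e2 : J (Fin n) ℂ * (X * y.1)ᵀ * J (Fin n) ℂ = -(y.1 * (J (Fin n) ℂ * Xᵀ * J (Fin n) ℂ)) := by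
    rw [transpose_mul, ← Matrix.mul_assoc, h2]
    simp [Matrix.mul_assoc]
  rw [transpose_sub, Matrix.mul_sub, Matrix.sub_mul, e1, e2]
  noncomm_ring

lemma spProj_coe (y : Sp n) : spProj y.1 = (2 : ℂ) • y := by
  apply Subtype.ext
  rw [spProj_val, J_mul_transpose y, Matrix.neg_mul, Matrix.mul_assoc, J_squared]
  simp [two_smul]

/-- The image in `𝔰𝔭_{2n}` of the matrix unit `E_{ab}`, a root vector if `a ≠ b`. -/
def rootVec (a b : Fin n ⊕ Fin n) : Sp n := spProj (Matrix.single a b 1)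

/-- The elements `rootVec a b` are redundant, as `(a, b)` and `(b.swap, a.swap)` give proportional
ones; the factor `1/2` compensates for this. -/
lemma eq_sum_rootVec (y : Sp n) : y = (2 : ℂ)⁻¹ • ∑ a, ∑ b, y.1 a b • rootVec a b := by
  have h : ∑ a, ∑ b, y.1 a b • rootVec a b = spProj y.1 := by
    conv_rhs => rw [matrix_eq_sum_single y.1]
    simp only [map_sum, rootVec]
    refine Finset.sum_congr rfl fun a _ => Finset.sum_congr rfl fun b _ => ?_
    rw [← map_smul, smul_single, smul_eq_mul, mul_one]
  rw [h, spProj_coe, smul_smul]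
  norm_num

lemma cartan_val (h : Fin n → ℂ) :
    (cartan h : Matrix (Fin n ⊕ Fin n) (Fin n ⊕ Fin n) ℂ) =
      diagonal (Sum.elim h (fun i => -h i)) := by
  rw [cartan, ← fromBlocks_diagonal]
  ext i j; by_cases hij : i = j <;> simp [hij]

lemma evalWeight_wt (a : Fin n ⊕ Fin n) (h : Fin n → ℂ) :
    evalWeight (wt a) h = Sum.elim h (fun i => -h i) a := by
  rcases a with i | i <;>
    simp [evalWeight, wt, eps, Pi.single_apply]

lemma evalWeight_add (μ ν : Weight n) (h : Fin n → ℂ) :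
    evalWeight (μ + ν) h = evalWeight μ h + evalWeight ν h := by
  simp [evalWeight, add_mul, Finset.sum_add_distrib]

lemma evalWeight_sub (μ ν : Weight n) (h : Fin n → ℂ) :
    evalWeight (μ - ν) h = evalWeight μ h - evalWeight ν h := by
  simp [evalWeight, sub_mul, Finset.sum_sub_distrib]

lemma evalWeight_intCast (μ ν : Weight n) :
    evalWeight μ (fun i => (ν i : ℂ)) = ((∑ i, μ i * ν i : ℤ) : ℂ) := by
  simp [evalWeight]

lemma sum_mul_wt (μ : Weight n) (a : Fin n ⊕ Fin n) : ∑ i, μ i * wt a i = coord μ a := by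
  rcases a with i | i <;> simp [wt, eps, coord, Pi.single_apply]

lemma lie_cartan_rootVec (h : Fin n → ℂ) (a b : Fin n ⊕ Fin n) :
    ⁅cartan h, rootVec a b⁆ = evalWeight (wt a - wt b) h • rootVec a b := by
  rw [rootVec, lie_spProj, cartan_val, ← map_smul, evalWeight_sub, evalWeight_wt, evalWeight_wt]
  refine congrArg spProj (Matrix.ext fun c d => ?_)
  simp only [Matrix.sub_apply, diagonal_mul, mul_diagonal, Matrix.smul_apply, smul_eq_mul,
    single_apply]
  split_ifs with hcd
  · rw [hcd.1, hcd.2]; ring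
  · simp

lemma J_mul_single_mul_J (a b : Fin n ⊕ Fin n) :
    J (Fin n) ℂ * Matrix.single b a 1 * J (Fin n) ℂ =
      Matrix.single b.swap a.swap (J (Fin n) ℂ b.swap b * J (Fin n) ℂ a a.swap) := by
  have hJ : ∀ c d : Fin n ⊕ Fin n, J (Fin n) ℂ c d = if d = c.swap then J (Fin n) ℂ c c.swap else 0 := by
    rintro (i | i) (j | j) <;> simp [J, one_apply, eq_comm]
    split_ifs <;> simp
  ext c d
  have h : (J (Fin n) ℂ * Matrix.single b a 1 * J (Fin n) ℂ :
      Matrix (Fin n ⊕ Fin n) (Fin n ⊕ Fin n) ℂ) c d =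
      J (Fin n) ℂ c b * J (Fin n) ℂ a d := by
    rw [Matrix.mul_assoc, mul_apply, Finset.sum_eq_single b]
    · rw [single_mul_apply_same, one_mul]
    · intro e _ he; rw [single_mul_apply_of_ne _ _ _ _ _ he, mul_zero]
    · simp
  rw [h, single_apply]
  by_cases h1 : b.swap = c
  · subst h1
    by_cases h2 : a.swap = d
    · simp [h2]
    · rw [hJ a d, if_neg (Ne.symm h2), if_neg (by tauto), mul_zero]
  · rw [hJ c b, if_neg, zero_mul, if_neg (by tauto)]
    intro h2; exact h1 (by rw [h2, Sum.swap_swap])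

lemma rootVec_val (a b : Fin n ⊕ Fin n) :
    (rootVec a b : Matrix (Fin n ⊕ Fin n) (Fin n ⊕ Fin n) ℂ) = Matrix.single a b 1 +
      Matrix.single b.swap a.swap (J (Fin n) ℂ b.swap b * J (Fin n) ℂ a a.swap) := by
  rw [rootVec, spProj_val, transpose_single, J_mul_single_mul_J]

lemma rootVec_self (a : Fin n ⊕ Fin n) : rootVec a a = cartan fun i => (wt a i : ℂ) := by
  apply Subtype.ext
  rw [rootVec_val, cartan_val]
  ext c d
  rcases a with i | i <;> rcases c with c | c <;> rcases d with d | d <;>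
    simp [J, single_apply, diagonal_apply, wt, eps, Pi.single_apply] <;> grind

/-- The factor `2` for the long roots and `1` for the short ones. -/
def longFactor (a b : Fin n ⊕ Fin n) : ℤ := if b = a.swap then 2 else 1

/-- For `b = a.swap` the two matrix units in `rootVec_val` coincide, so the root vector is twice a
matrix unit; this is where `longFactor` comes from. -/
lemma lie_rootVec_rootVec {a b : Fin n ⊕ Fin n} (hab : a ≠ b) :
    ⁅rootVec a b, rootVec b a⁆ = (longFactor a b : ℂ) • (rootVec a a - rootVec b b) := by
  conv_lhs => rw [rootVec.eq_def b a, lie_spProj, rootVec_val]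
  rw [rootVec, rootVec, ← map_sub, ← map_smul]
  congr 1
  rw [Matrix.add_mul, Matrix.mul_add, single_mul_single_same, single_mul_single_same]
  by_cases h : b = a.swap
  · subst h
    have : J (Fin n) ℂ a a.swap * J (Fin n) ℂ a a.swap = 1 := by rcases a with i | i <;> simp [J]
    simp only [longFactor, Sum.swap_swap, single_mul_single_same, mul_one, this, if_true]
    push_cast
    rw [two_smul]; abel
  · have h1 : a.swap ≠ b := Ne.symm h
    have h2 : a ≠ b.swap := by intro h3; exact h (by rw [h3, Sum.swap_swap])
    rw [single_mul_single_of_ne _ _ _ _ h1, single_mul_single_of_ne _ _ _ _ h2]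
    simp [longFactor, h]

/-- This is the invariance of the tensor `∑ E_ab ⊗ E_ba`. It is used for the bilinear map that
multiplies the actions of two elements, to show that the Casimir operator is central. -/
lemma sum_bilin_lie_single {m E : Type*} [Fintype m] [DecidableEq m] [AddCommGroup E] [Module ℂ E]
    (B : Matrix m m ℂ →ₗ[ℂ] Matrix m m ℂ →ₗ[ℂ] E) (Y : Matrix m m ℂ) :
    ∑ a, ∑ b, (B (Y * Matrix.single a b 1 - Matrix.single a b 1 * Y) (Matrix.single b a 1) +
      B (Matrix.single a b 1) (Y * Matrix.single b a 1 - Matrix.single b a 1 * Y)) = 0 := by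
  have h1 : ∀ a b, Y * Matrix.single a b 1 = ∑ c, Y c a • Matrix.single c b (1 : ℂ) := by
    intro a b
    ext i j
    simp [Matrix.sum_apply, single_apply, mul_apply, ite_and]
  have h2 : ∀ a b, Matrix.single a b 1 * Y = ∑ c, Y b c • Matrix.single a c (1 : ℂ) := by
    intro a b
    ext i j
    simp [Matrix.sum_apply, single_apply, mul_apply, ite_and]
  simp only [h1, h2, map_sub, map_sum, map_smul, LinearMap.sub_apply, LinearMap.sum_apply,
    LinearMap.smul_apply, Finset.sum_add_distrib, Finset.sum_sub_distrib]
  have e1 : ∑ a, ∑ b, ∑ c, Y c a • B (Matrix.single c b 1) (Matrix.single b a 1) =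
      ∑ a, ∑ b, ∑ c, Y a c • B (Matrix.single a b 1) (Matrix.single b c 1) := by
    rw [Finset.sum_comm]
    conv_rhs => rw [Finset.sum_comm]
    exact Finset.sum_congr rfl fun b _ => Finset.sum_comm
  have e2 : ∑ a, ∑ b, ∑ c, Y b c • B (Matrix.single a c 1) (Matrix.single b a 1) =
      ∑ a, ∑ b, ∑ c, Y c b • B (Matrix.single a b 1) (Matrix.single c a 1) :=
    Finset.sum_congr rfl fun a _ => Finset.sum_comm
  rw [e1, e2]
  abel

end RootVectors

/-! ### Weight spaces -/

section WeightSpaces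

open Matrix

variable {n : ℕ} {V : Type} [AddCommGroup V] [Module ℂ V] [LieRingModule (Sp n) V]
  [LieModule ℂ (Sp n) V]

lemma mem_weightSpace {μ : Weight n} {v : V} :
    v ∈ weightSpace V μ ↔ ∀ h : Fin n → ℂ, ⁅cartan h, v⁆ = evalWeight μ h • v := by
  simp [weightSpace, Submodule.mem_iInf]

lemma lie_mem_weightSpace {α : Weight n} {x : Sp n}
    (hx : ∀ h : Fin n → ℂ, ⁅cartan h, x⁆ = evalWeight α h • x) {μ : Weight n} {v : V}
    (hv : v ∈ weightSpace V μ) : ⁅x, v⁆ ∈ weightSpace V (μ + α) := by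
  rw [mem_weightSpace] at hv ⊢
  intro h
  rw [leibniz_lie, hx, hv, lie_smul, smul_lie, evalWeight_add, add_smul, add_comm]

lemma rootVec_lie_mem (a b : Fin n ⊕ Fin n) {μ : Weight n} {v : V} (hv : v ∈ weightSpace V μ) :
    ⁅rootVec a b, v⁆ ∈ weightSpace V (μ + (wt a - wt b)) :=
  lie_mem_weightSpace (fun h => lie_cartan_rootVec h a b) hv

lemma rootVec_self_lie (a : Fin n ⊕ Fin n) {μ : Weight n} {v : V} (hv : v ∈ weightSpace V μ) :
    ⁅rootVec a a, v⁆ = (coord μ a : ℂ) • v := by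
  rw [rootVec_self, mem_weightSpace.1 hv, evalWeight_intCast, sum_mul_wt]

lemma evalWeight_injective : Function.Injective fun (μ : Weight n) h => evalWeight μ h := by
  intro μ ν h
  ext i
  have := congrFun h (fun j => ((eps i j : ℤ) : ℂ))
  simp only [evalWeight_intCast] at this
  have h2 : ∑ j, μ j * eps i j = ∑ j, ν j * eps i j := by exact_mod_cast this
  simpa [eps, Pi.single_apply] using h2

lemma cartan_lie_cartan (h h' : Fin n → ℂ) : ⁅cartan h, cartan h'⁆ = 0 := by
  apply Subtype.ext
  rw [LieSubalgebra.coe_bracket, Ring.lie_def, cartan_val, cartan_val, diagonal_mul_diagonal,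
    diagonal_mul_diagonal]
  simp [mul_comm]

-- Weight spaces lie in simultaneous generalized eigenspaces of the commuting Cartan operators, and
-- a weight is determined by its eigenvalues.
variable (V) in
lemma iSupIndep_weightSpace : iSupIndep fun μ : Weight n => weightSpace V μ := by
  have h := Module.End.independent_iInf_maxGenEigenspace_of_forall_mapsTo
    (fun h : Fin n → ℂ => LieModule.toEnd ℂ (Sp n) V (cartan h)) (fun h h' φ =>
      Module.End.mapsTo_maxGenEigenspace_of_comm (by
        rw [commute_iff_lie_eq, ← LieHom.map_lie, cartan_lie_cartan, map_zero]) φ)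
  refine (h.comp evalWeight_injective).mono fun μ => ?_
  exact iInf_mono fun i => Module.End.genEigenspace_le_maximal _ _ 1

variable (V) in
/-- The multiplicity of a weight. -/
def mult (μ : Weight n) : ℕ := Module.finrank ℂ (weightSpace V μ)

variable (V) in
lemma finite_support_mult [FiniteDimensional ℂ V] :
    (Function.support (mult V (n := n))).Finite := by
  refine (WellFoundedGT.finite_ne_bot_of_iSupIndep (iSupIndep_weightSpace V)).subset fun μ hμ h => ?_
  apply hμ
  change Module.finrank ℂ (weightSpace V μ) = 0
  rw [h, finrank_bot]

/-! ### Dominance -/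

/-- A weight is dominant if its coordinates are weakly decreasing and nonnegative. -/
def IsDominant (s : Weight n) : Prop := Antitone s ∧ ∀ i, 0 ≤ s i

lemma dotProduct_nonneg_of_mem_positiveRoots {α s : Weight n} (hα : α ∈ positiveRoots n)
    (hs : IsDominant s) : 0 ≤ α ⬝ᵥ s := by
  rcases hα with ⟨i, j, hij, rfl | rfl⟩ | ⟨i, rfl⟩
  · simpa [eps, sub_dotProduct] using hs.1 hij.le
  · simpa [eps, add_dotProduct] using add_nonneg (hs.2 i) (hs.2 j)
  · rw [smul_dotProduct]
    simpa [eps] using hs.2 i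

lemma dotProduct_rho_pos {α : Weight n} (hα : α ∈ positiveRoots n) : 0 < α ⬝ᵥ rho n := by
  rcases hα with ⟨i, j, hij, rfl | rfl⟩ | ⟨i, rfl⟩
  · simpa [eps, sub_dotProduct, rho] using hij
  · have := i.2; have := j.2
    simp [eps, add_dotProduct, rho]; lia
  · have := i.2
    rw [smul_dotProduct]
    simp [eps, rho]

lemma wt_sub_wt_mem {a b : Fin n ⊕ Fin n} (hab : a ≠ b) :
    wt a - wt b ∈ positiveRoots n ∨ wt b - wt a ∈ positiveRoots n := by
  rcases a with i | i <;> rcases b with j | j <;> simp only [wt, Sum.elim_inl, Sum.elim_inr]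
  · rcases lt_or_gt_of_ne (show i ≠ j from fun h => hab (by rw [h])) with h | h
    · exact .inl (.inl ⟨i, j, h, .inl rfl⟩)
    · exact .inr (.inl ⟨j, i, h, .inl rfl⟩)
  · left
    rcases lt_trichotomy i j with h | rfl | h
    · exact .inl ⟨i, j, h, .inr (by abel)⟩
    · exact .inr ⟨i, by rw [two_smul]; abel⟩
    · exact .inl ⟨j, i, h, .inr (by abel)⟩
  · right
    rcases lt_trichotomy i j with h | rfl | h
    · exact .inl ⟨i, j, h, .inr (by abel)⟩
    · exact .inr ⟨i, by rw [two_smul]; abel⟩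
    · exact .inl ⟨j, i, h, .inr (by abel)⟩
  · rcases lt_or_gt_of_ne (show i ≠ j from fun h => hab (by rw [h])) with h | h
    · exact .inr (.inl ⟨i, j, h, .inl (by abel)⟩)
    · exact .inl (.inl ⟨j, i, h, .inl (by abel)⟩)

/-- `μ` is strictly below `lam` in the dominance order. -/
def IsBelow (lam μ : Weight n) : Prop :=
  (∀ s, IsDominant s → μ ⬝ᵥ s ≤ lam ⬝ᵥ s) ∧ μ ⬝ᵥ rho n < lam ⬝ᵥ rho n

lemma isBelow_sub {lam μ α : Weight n} (h : μ = lam ∨ IsBelow lam μ) (hα : α ∈ positiveRoots n) :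
    IsBelow lam (μ - α) := by
  have h' : (∀ s, IsDominant s → μ ⬝ᵥ s ≤ lam ⬝ᵥ s) ∧ μ ⬝ᵥ rho n ≤ lam ⬝ᵥ rho n := by
    rcases h with rfl | h
    · exact ⟨fun _ _ => le_rfl, le_rfl⟩
    · exact ⟨h.1, h.2.le⟩
  refine ⟨fun s hs => ?_, ?_⟩ <;> rw [sub_dotProduct]
  · linarith [h'.1 s hs, dotProduct_nonneg_of_mem_positiveRoots hα hs]
  · linarith [h'.2, dotProduct_rho_pos hα]

/-! ### The lowering filtration of a highest weight module -/

/-- The span of the images of `v` under at most `N` lowering operators. -/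
def lowering (v : V) : ℕ → Submodule ℂ V
  | 0 => Submodule.span ℂ {v}
  | N + 1 => lowering v N ⊔ Submodule.span ℂ
      {u | ∃ a b : Fin n ⊕ Fin n, wt b - wt a ∈ positiveRoots n ∧
        ∃ w ∈ lowering v N, u = ⁅rootVec a b, w⁆}

lemma lie_mem_of_rootVec {S T : Submodule ℂ V}
    (h : ∀ a b : Fin n ⊕ Fin n, ∀ w ∈ S, ⁅rootVec a b, w⁆ ∈ T) (y : Sp n) {w : V} (hw : w ∈ S) :
    ⁅y, w⁆ ∈ T := by
  rw [eq_sum_rootVec y, smul_lie, sum_lie]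
  refine T.smul_mem _ (T.sum_mem fun a _ => ?_)
  rw [sum_lie]
  refine T.sum_mem fun b _ => ?_
  rw [smul_lie]
  exact T.smul_mem _ (h a b w hw)

lemma lowering_step {v : V} {N : ℕ} {a b : Fin n ⊕ Fin n} (hab : wt b - wt a ∈ positiveRoots n)
    {w : V} (hw : w ∈ lowering (n := n) v N) : ⁅rootVec a b, w⁆ ∈ lowering (n := n) v (N + 1) :=
  Submodule.mem_sup_right (Submodule.subset_span ⟨a, b, hab, w, hw, rfl⟩)

lemma lowering_le_succ (v : V) (N : ℕ) : lowering (n := n) v N ≤ lowering (n := n) v (N + 1) :=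
  le_sup_left

/-- Each stage is stable under the Borel subalgebra. Moving `x` past a lowering operator `f` gives
`x f w = [x, f] w + f x w`; an arbitrary element of the algebra raises the stage by at most one,
which handles the first term, and the induction hypothesis handles the second. No PBW basis enters.
-/
lemma rootVec_lie_lowering {lam : Weight n} {v : V} (hv : IsHighestWeightVector V lam v) (N : ℕ) :
    ∀ a b : Fin n ⊕ Fin n, (a = b ∨ wt a - wt b ∈ positiveRoots n) →
      ∀ w ∈ lowering (n := n) v N, ⁅rootVec a b, w⁆ ∈ lowering (n := n) v N := by
  induction N with
  | zero =>
    intro a b hab w hw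
    obtain ⟨c, rfl⟩ := Submodule.mem_span_singleton.1 hw
    rw [lie_smul]
    refine Submodule.smul_mem _ _ ?_
    rcases hab with rfl | hab
    · rw [rootVec_self_lie a hv.2.1]
      exact Submodule.smul_mem _ _ (Submodule.mem_span_singleton_self v)
    · rw [hv.2.2 _ hab (rootVec a b) fun h => lie_cartan_rootVec h a b]
      exact zero_mem _
  | succ N ih =>
    have all : ∀ (y : Sp n), ∀ w ∈ lowering (n := n) v N, ⁅y, w⁆ ∈ lowering (n := n) v (N + 1) := by
      intro y w hw
      refine lie_mem_of_rootVec (fun a b w hw => ?_) y hw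
      by_cases hab : a = b
      · exact lowering_le_succ v N (ih a b (.inl hab) w hw)
      rcases wt_sub_wt_mem hab with h | h
      · exact lowering_le_succ v N (ih a b (.inr h) w hw)
      · exact lowering_step h hw
    intro a b hab w hw
    obtain ⟨w₁, hw₁, w₂, hw₂, rfl⟩ := Submodule.mem_sup.1 hw
    rw [lie_add]
    refine add_mem (all _ _ hw₁) ?_
    clear hw
    induction hw₂ using Submodule.span_induction with
    | mem u hu =>
      obtain ⟨c, d, hcd, u, hu, rfl⟩ := hu
      rw [leibniz_lie]
      exact add_mem (all _ _ hu) (lowering_step hcd (ih a b hab u hu))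
    | zero => simp
    | add u₁ u₂ _ _ h₁ h₂ =>
      rw [lie_add]
      exact add_mem h₁ h₂
    | smul c u _ h =>
      rw [lie_smul]
      exact Submodule.smul_mem _ _ h

lemma lowering_mono (v : V) : Monotone (lowering (n := n) v) :=
  monotone_nat_of_le_succ (lowering_le_succ v)

/-- The submodule generated by a highest weight vector. -/
def loweringSubmodule {lam : Weight n} {v : V} (hv : IsHighestWeightVector V lam v) :
    LieSubmodule ℂ (Sp n) V where
  __ := ⨆ N, lowering (n := n) v N
  lie_mem := by
    intro y w hw
    change w ∈ ⨆ N, lowering (n := n) v N at hw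
    change _ ∈ ⨆ N, lowering (n := n) v N
    obtain ⟨N, hN⟩ := (Submodule.mem_iSup_of_directed _ (lowering_mono v).directed_le).1 hw
    refine (le_iSup (lowering (n := n) v) (N + 1)) ?_
    refine lie_mem_of_rootVec (fun a b w hw => ?_) y hN
    by_cases hab : a = b
    · exact lowering_le_succ v N (rootVec_lie_lowering hv N a b (.inl hab) w hw)
    rcases wt_sub_wt_mem hab with h | h
    · exact lowering_le_succ v N (rootVec_lie_lowering hv N a b (.inr h) w hw)
    · exact lowering_step h hw

lemma lowering_le_weights {lam : Weight n} {v : V} (hv : IsHighestWeightVector V lam v) (N : ℕ) :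
    lowering (n := n) v N ≤
      Submodule.span ℂ {v} ⊔ ⨆ μ ∈ {μ | IsBelow lam μ}, weightSpace V μ := by
  induction N with
  | zero => exact le_sup_left
  | succ N ih =>
    refine sup_le ih (Submodule.span_le.2 ?_)
    rintro _ ⟨a, b, hab, w, hw, rfl⟩
    have hstep : ∀ μ : Weight n, (μ = lam ∨ IsBelow lam μ) → ∀ u ∈ weightSpace V μ,
        ⁅rootVec a b, u⁆ ∈ ⨆ μ ∈ {μ | IsBelow lam μ}, weightSpace V μ := by
      intro μ hμ u hu
      have h1 := rootVec_lie_mem a b hu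
      have h2 := isBelow_sub hμ hab
      rw [show μ + (wt a - wt b) = μ - (wt b - wt a) by abel] at h1
      exact (le_biSup (weightSpace V) (show μ - (wt b - wt a) ∈ {μ | IsBelow lam μ} from h2)) h1
    obtain ⟨w₁, hw₁, w₂, hw₂, rfl⟩ := Submodule.mem_sup.1 (ih hw)
    obtain ⟨c, rfl⟩ := Submodule.mem_span_singleton.1 hw₁
    rw [SetLike.mem_coe, lie_add]
    refine Submodule.mem_sup_right (add_mem ?_ ?_)
    · rw [lie_smul]
      exact Submodule.smul_mem _ _ (hstep lam (.inl rfl) v hv.2.1)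
    · have : (⨆ μ ∈ {μ | IsBelow lam μ}, weightSpace V μ) ≤
          (⨆ μ ∈ {μ | IsBelow lam μ}, weightSpace V μ).comap
            (LieModule.toEnd ℂ (Sp n) V (rootVec a b)) :=
        iSup₂_le fun μ hμ u hu => hstep μ (.inr hμ) u hu
      exact this hw₂

/-- The submodule generated by `v` is everything. With the independence of weight spaces, this
yields both the multiplicity one of `lam` and the bound on all the other weights. -/
lemma span_sup_weights_eq_top [LieModule.IsIrreducible ℂ (Sp n) V] {lam : Weight n} {v : V}
    (hv : IsHighestWeightVector V lam v) :
    Submodule.span ℂ {v} ⊔ ⨆ μ ∈ {μ | IsBelow lam μ}, weightSpace V μ = ⊤ := by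
  have hmem : v ∈ loweringSubmodule hv :=
    le_iSup (lowering (n := n) v) 0 (Submodule.mem_span_singleton_self v)
  have htop : loweringSubmodule hv = ⊤ := by
    refine (eq_bot_or_eq_top (loweringSubmodule hv)).resolve_left fun h => hv.1 ?_
    rw [h] at hmem
    simpa using hmem
  refine top_le_iff.1 fun w _ => ?_
  have hw : w ∈ loweringSubmodule hv := by rw [htop]; trivial
  exact iSup_le (lowering_le_weights hv) hw

lemma not_isBelow_self (lam : Weight n) : ¬ IsBelow lam lam := fun h => lt_irrefl _ h.2

/-- All weights of a simple module other than the highest one lie below it. -/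
lemma isBelow_of_mult_ne_zero [LieModule.IsIrreducible ℂ (Sp n) V] {lam : Weight n} {v : V}
    (hv : IsHighestWeightVector V lam v) {μ : Weight n} (hμ : mult V μ ≠ 0) (hne : μ ≠ lam) :
    IsBelow lam μ := by
  by_contra hb
  apply hμ
  have hbot : weightSpace V μ = ⊥ := by
    have hd := (iSupIndep_weightSpace V).disjoint_biSup (x := μ)
      (y := {μ | μ = lam ∨ IsBelow lam μ}) (by simp [hne, hb])
    refine hd.eq_bot_of_le (le_top.trans ?_)
    rw [← span_sup_weights_eq_top hv]
    refine sup_le (Submodule.span_le.2 (Set.singleton_subset_iff.2 ?_)) (iSup₂_le fun ν hν => ?_)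
    · exact le_biSup (weightSpace V) (show lam ∈ {μ | μ = lam ∨ IsBelow lam μ} from .inl rfl) hv.2.1
    · exact le_biSup (weightSpace V) (show ν ∈ {μ | μ = lam ∨ IsBelow lam μ} from .inr hν)
  rw [mult, hbot, finrank_bot]

/-- The highest weight has multiplicity one. -/
lemma mult_highestWeight [LieModule.IsIrreducible ℂ (Sp n) V] {lam : Weight n} {v : V}
    (hv : IsHighestWeightVector V lam v) : mult V lam = 1 := by
  have hspan : weightSpace V lam = Submodule.span ℂ {v} := by
    refine le_antisymm (fun w hw => ?_) (Submodule.span_le.2 (Set.singleton_subset_iff.2 hv.2.1))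
    have htop : w ∈ Submodule.span ℂ {v} ⊔ ⨆ μ ∈ {μ | IsBelow lam μ}, weightSpace V μ := by
      rw [span_sup_weights_eq_top hv]; trivial
    obtain ⟨w₁, hw₁, w₂, hw₂, rfl⟩ := Submodule.mem_sup.1 htop
    have hd := (iSupIndep_weightSpace V).disjoint_biSup (x := lam)
      (y := {μ | IsBelow lam μ}) (not_isBelow_self lam)
    have h1 : w₁ ∈ weightSpace V lam :=
      (Submodule.span_le.2 (Set.singleton_subset_iff.2 hv.2.1)) hw₁
    have h2 : w₂ ∈ weightSpace V lam := by simpa using sub_mem hw h1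
    have : w₂ = 0 := Submodule.disjoint_def.1 hd w₂ h2 hw₂
    rw [this, add_zero]
    exact hw₁
  rw [mult, hspan, finrank_span_singleton hv.1]

end WeightSpaces

/-! ### Invariance of multiplicities under the Weyl group -/

section Sl2

variable {V : Type*} [AddCommGroup V] [Module ℂ V] {E F H : Module.End ℂ V}

lemma apply_pow_of_shift {c : ℂ} (hHE : H * E - E * H = c • E) {u : V} {m : ℂ} (hu : H u = m • u)
    (i : ℕ) : H ((E ^ i) u) = (m + c * i) • (E ^ i) u := by
  induction i with
  | zero => simpa using hu
  | succ i ih =>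
    have h := LinearMap.congr_fun hHE ((E ^ i) u)
    simp only [LinearMap.sub_apply, Module.End.mul_apply, LinearMap.smul_apply] at h
    rw [pow_succ', Module.End.mul_apply, sub_eq_iff_eq_add.1 h, ih, map_smul, ← add_smul]
    congr 1
    push_cast; ring

/-- Otherwise `H` would have the infinitely many eigenvalues `m + c * i`. -/
lemma exists_pow_eq_zero_of_shift [FiniteDimensional ℂ V] {c : ℂ} (hc : c ≠ 0)
    (hHE : H * E - E * H = c • E) {u : V} {m : ℂ} (hu : H u = m • u) : ∃ i, (E ^ i) u = 0 := by
  by_contra! hne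
  have hinj : Function.Injective fun i : ℕ => m + c * i := by
    intro i j hij
    simpa [hc] using hij
  have hfin : (Set.range fun i : ℕ => m + c * i).Finite := by
    refine (Module.End.finite_hasEigenvalue H).subset ?_
    rintro _ ⟨i, rfl⟩
    exact Module.End.hasEigenvalue_of_hasEigenvector
      ⟨Module.End.mem_eigenspace_iff.2 (apply_pow_of_shift hHE hu i), hne i⟩
  exact Set.infinite_range_of_injective hinj hfin

lemma exists_last_pow {u : V} (hu : u ≠ 0) {k : ℕ} (h : (E ^ k) u = 0) :
    ∃ i < k, (E ^ i) u ≠ 0 ∧ E ((E ^ i) u) = 0 := by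
  classical
  have hex : ∃ k, (E ^ k) u = 0 := ⟨k, h⟩
  have h0 : Nat.find hex ≠ 0 := by
    intro h0
    have := Nat.find_spec hex
    rw [h0] at this
    exact hu (by simpa using this)
  obtain ⟨i, hi⟩ := Nat.exists_eq_succ_of_ne_zero h0
  have hle := Nat.find_min' hex h
  refine ⟨i, by lia, Nat.find_min hex (by lia), ?_⟩
  have := Nat.find_spec hex
  rwa [hi, Nat.succ_eq_add_one, pow_succ', Module.End.mul_apply] at this

/-- In a finite-dimensional representation of `𝔰𝔩₂`, the `k`-th power of the lowering operator is
injective on the weight space of weight `k`. -/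
lemma eq_zero_of_pow_lower_eq_zero [FiniteDimensional ℂ V] (hEF : E * F - F * E = H)
    (hHE : H * E - E * H = (2 : ℂ) • E) (hHF : H * F - F * H = (-2 : ℂ) • F) {k : ℕ} {v : V}
    (hv : H v = (k : ℂ) • v) (hk : (F ^ k) v = 0) : v = 0 := by
  by_contra hv0
  -- A multiple of the Casimir operator of `𝔰𝔩₂`, up to normalization. It commutes with `E`, `F` and
  -- `H`, so it has an eigenvector `u` among the vectors of weight `k` killed by `F ^ k`.
  set C : Module.End ℂ V := (4 : ℂ) • (F * E) + H * H + (2 : ℂ) • H with hC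
  have hHE' : H * E = E * H + (2 : ℂ) • E := sub_eq_iff_eq_add'.1 hHE
  have hHF' : H * F = F * H + (-2 : ℂ) • F := sub_eq_iff_eq_add'.1 hHF
  have hEF' : E * F = F * E + H := sub_eq_iff_eq_add'.1 hEF
  have hCH : Commute C H := by
    have e : H * F * E = F * E * H := by
      rw [hHF', add_mul, mul_assoc, hHE', mul_add, smul_mul_assoc, mul_smul_comm, ← mul_assoc]
      module
    change C * H = H * C
    simp only [hC, add_mul, mul_add, smul_mul_assoc, mul_smul_comm, ← mul_assoc, e]
  have hCE : Commute C E := by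
    change C * E = E * C
    simp only [hC, add_mul, mul_add, smul_mul_assoc, mul_smul_comm]
    rw [← mul_assoc E F E, hEF', mul_assoc H H E, hHE', mul_add, ← mul_assoc H E H, hHE']
    simp only [add_mul, smul_mul_assoc, mul_smul_comm, smul_add, hHE', mul_assoc]
    module
  have hCF : Commute C F := by
    change C * F = F * C
    simp only [hC, add_mul, mul_add, smul_mul_assoc, mul_smul_comm]
    rw [mul_assoc F E F, hEF', mul_assoc H H F, hHF']
    simp only [mul_add, mul_smul_comm]
    rw [← mul_assoc H F H, hHF']
    simp only [add_mul, smul_mul_assoc, smul_add, mul_assoc]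
    module
  let U : Submodule ℂ V := LinearMap.ker (F ^ k) ⊓ Module.End.eigenspace H (k : ℂ)
  have hU : ∀ u ∈ U, C u ∈ U := by
    rintro u ⟨h1, h2⟩
    refine ⟨?_, ?_⟩
    · have := LinearMap.congr_fun (hCF.pow_right k).eq u
      simp only [Module.End.mul_apply] at this
      change (F ^ k) (C u) = 0
      rw [← this, LinearMap.mem_ker.1 h1, map_zero]
    · rw [SetLike.mem_coe, Module.End.mem_eigenspace_iff] at h2 ⊢
      have := LinearMap.congr_fun hCH.eq u
      simp only [Module.End.mul_apply] at this
      rw [← this, h2, map_smul]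
  have : Nontrivial U := ⟨⟨⟨v, hk, Module.End.mem_eigenspace_iff.2 hv⟩, 0, fun h =>
    hv0 (congrArg Subtype.val h)⟩⟩
  obtain ⟨c, hc⟩ := Module.End.exists_eigenvalue (C.restrict hU)
  obtain ⟨⟨u, huF, huH⟩, hu⟩ := hc.exists_hasEigenvector
  have hCu : C u = c • u := congrArg Subtype.val hu.apply_eq_smul
  have hu0 : u ≠ 0 := fun h => hu.2 (Subtype.ext h)
  have hHu : H u = (k : ℂ) • u := Module.End.mem_eigenspace_iff.1 huH
  have hcomm : ∀ {X : Module.End ℂ V}, Commute C X → ∀ i, C ((X ^ i) u) = c • (X ^ i) u := by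
    intro X hX i
    have := LinearMap.congr_fun (hX.pow_right i).eq u
    simp only [Module.End.mul_apply] at this
    rw [this, hCu, map_smul]
  -- Raise `u` to a vector of weight `k + 2i` killed by `E`, and lower it to one of weight `k - 2j`
  -- killed by `F`, with `j < k`. The eigenvalue of `C` is computed at both ends.
  obtain ⟨N, hN⟩ := exists_pow_eq_zero_of_shift two_ne_zero hHE hHu
  obtain ⟨i, -, hi, hEi⟩ := exists_last_pow hu0 hN
  obtain ⟨j, hjk, hj, hFj⟩ := exists_last_pow hu0 (LinearMap.mem_ker.1 huF)
  have h1 : c = ((k + 2 * i : ℤ) : ℂ) ^ 2 + 2 * ((k + 2 * i : ℤ) : ℂ) := by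
    have h := hcomm hCE i
    have hw := apply_pow_of_shift hHE hHu i
    simp only [hC, LinearMap.add_apply, LinearMap.smul_apply, Module.End.mul_apply, hEi, map_zero,
      smul_zero, zero_add, hw, map_smul, smul_smul, ← add_smul] at h
    have := smul_left_injective ℂ hi h
    rw [← this]; push_cast; ring
  have h2 : c = ((k - 2 * j : ℤ) : ℂ) ^ 2 - 2 * ((k - 2 * j : ℤ) : ℂ) := by
    have h := hcomm hCF j
    have hw := apply_pow_of_shift hHF hHu j
    have hFE := LinearMap.congr_fun hEF' ((F ^ j) u)
    simp only [Module.End.mul_apply, LinearMap.add_apply, hFj, map_zero] at hFE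
    have hFE' : F (E ((F ^ j) u)) = -H ((F ^ j) u) := (neg_eq_of_add_eq_zero_left hFE.symm).symm
    simp only [hC, LinearMap.add_apply, LinearMap.smul_apply, Module.End.mul_apply, hFE',
      hw, map_smul, smul_smul, ← add_smul, ← neg_smul] at h
    have := smul_left_injective ℂ hj h
    rw [← this]; push_cast; ring
  have h3 : ((k : ℤ) + 2 * i) ^ 2 + 2 * (k + 2 * i) = (k - 2 * j) ^ 2 - 2 * (k - 2 * j) := by
    exact_mod_cast h1.symm.trans h2
  -- Completing the square leaves `i + j = -1` or `j = k + i`; both are impossible since `j < k`.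
  have h4 : ((k : ℤ) + 2 * i + 1) ^ 2 = (k - 2 * j - 1) ^ 2 := by linarith
  rcases sq_eq_sq_iff_eq_or_eq_neg.1 h4 with h | h <;> lia

end Sl2

/-! ### Multiplicities under signed permutations -/

section WeylInvariance

open Matrix

variable {n : ℕ} {V : Type} [AddCommGroup V] [Module ℂ V] [LieRingModule (Sp n) V]
  [LieModule ℂ (Sp n) V]

lemma lie_rootVec_self_rootVec (a b c : Fin n ⊕ Fin n) :
    ⁅rootVec c c, rootVec a b⁆ = (coord (wt a - wt b) c : ℂ) • rootVec a b := by
  rw [rootVec_self, lie_cartan_rootVec, evalWeight_intCast, sum_mul_wt]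

/-- With `α = wt a - wt b`, the condition `hc` says that `c` times the two root vectors generate an
`𝔰𝔩₂`-triple, and `k` is the pairing of `μ` with the coroot. The weight on the right is the
reflection of `μ`, reached by the injective `F ^ k`. Short roots take `c = 1` and long ones `c = 1 /
2`. -/
lemma mult_le_mult_sub [FiniteDimensional ℂ V] {a b : Fin n ⊕ Fin n} (hab : a ≠ b) {c : ℚ}
    (hc : c ^ 2 * longFactor a b * (coord (wt a - wt b) a - coord (wt a - wt b) b) = 2)
    {μ : Weight n} {k : ℕ} (hk : c ^ 2 * longFactor a b * (coord μ a - coord μ b) = k) :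
    mult V μ ≤ mult V (μ - k • (wt a - wt b)) := by
  let φ := LieModule.toEnd ℂ (Sp n) V
  let d : ℂ := c ^ 2 * longFactor a b
  let E := (c : ℂ) • φ (rootVec a b)
  let F := (c : ℂ) • φ (rootVec b a)
  let H := d • (φ (rootVec a a) - φ (rootVec b b))
  have hmul : ∀ x y : Sp n, φ x * φ y - φ y * φ x = φ ⁅x, y⁆ := fun x y => by
    rw [LieHom.map_lie, Ring.lie_def]
  have hEF : E * F - F * E = H := by
    simp only [E, F, H, d, smul_mul_smul_comm, ← smul_sub, hmul, lie_rootVec_rootVec hab, map_smul,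
      map_sub, smul_smul]
    congr 1; ring
  have hd : d * (coord (wt a - wt b) a - coord (wt a - wt b) b) = 2 := by
    have := congrArg (Rat.cast : ℚ → ℂ) hc
    push_cast at this
    exact this
  have hHX : ∀ x y, (φ (rootVec a a) - φ (rootVec b b)) * φ (rootVec x y) -
      φ (rootVec x y) * (φ (rootVec a a) - φ (rootVec b b)) =
      ((coord (wt x - wt y) a - coord (wt x - wt y) b : ℤ) : ℂ) • φ (rootVec x y) := by
    intro x y
    rw [← map_sub, hmul, sub_lie, lie_rootVec_self_rootVec, lie_rootVec_self_rootVec, ← sub_smul,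
      map_smul]
    push_cast; rfl
  have hHE : H * E - E * H = (2 : ℂ) • E := by
    simp only [E, H, smul_mul_smul_comm, mul_comm (c : ℂ) d, ← smul_sub, hHX, smul_smul, ← hd]
    push_cast; congr 1; ring
  have hneg : ∀ x, coord (wt b - wt a) x = -coord (wt a - wt b) x := by
    intro x; rw [← neg_sub (wt a) (wt b)]; rcases x with x | x <;> simp [coord]
  have hHF : H * F - F * H = (-2 : ℂ) • F := by
    simp only [F, H, smul_mul_smul_comm, mul_comm (c : ℂ) d, ← smul_sub, hHX, smul_smul, ← hd, hneg]
    push_cast; congr 1; ring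
  have hmem : ∀ i : ℕ, ∀ v ∈ weightSpace V μ, (F ^ i) v ∈ weightSpace V (μ - i • (wt a - wt b)) := by
    intro i
    induction i with
    | zero => intro v hv; simpa using hv
    | succ i ih =>
      intro v hv
      rw [pow_succ', Module.End.mul_apply]
      refine Submodule.smul_mem _ _ ?_
      have := rootVec_lie_mem b a (ih v hv)
      rwa [show μ - i • (wt a - wt b) + (wt b - wt a) = μ - (i + 1) • (wt a - wt b) by
        rw [succ_nsmul]; abel] at this
  refine LinearMap.finrank_le_finrank_of_injective (f := (F ^ k).restrict (hmem k)) ?_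
  rw [← LinearMap.ker_eq_bot, LinearMap.ker_eq_bot']
  rintro ⟨v, hv⟩ h
  refine Subtype.ext (eq_zero_of_pow_lower_eq_zero hEF hHE hHF (k := k) ?_ (congrArg Subtype.val h))
  have hk' : d * (coord μ a - coord μ b) = k := by
    have := congrArg (Rat.cast : ℚ → ℂ) hk
    push_cast at this
    exact this
  change d • (⁅rootVec a a, v⁆ - ⁅rootVec b b, v⁆) = _
  rw [rootVec_self_lie a hv, rootVec_self_lie b hv, ← sub_smul, smul_smul, hk']

lemma mult_comp_swap [FiniteDimensional ℂ V] (μ : Weight n) (i j : Fin n) :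
    mult V (μ ∘ Equiv.swap i j) = mult V μ := by
  rcases eq_or_ne i j with rfl | hij
  · simp
  -- The order of `μ i` and `μ j` makes the pairing a natural number. Equality follows later, as the
  -- reflection is an involution.
  have aux : ∀ (i j : Fin n), i ≠ j → ∀ μ : Weight n, μ j ≤ μ i →
      mult V μ ≤ mult V (μ ∘ Equiv.swap i j) := by
    intro i j hij μ h
    have key := mult_le_mult_sub (V := V) (a := .inl i) (b := .inl j) (by simpa using hij) (c := 1)
      (μ := μ) (k := (μ i - μ j).toNat) (by
        simp [longFactor, coord, wt, eps, hij, hij.symm]; norm_num) (by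
        have : ((μ i - μ j).toNat : ℤ) = μ i - μ j := Int.toNat_of_nonneg (by lia)
        have h2 : (((μ i - μ j).toNat : ℤ) : ℚ) = ((μ i - μ j : ℤ) : ℚ) := by rw [this]
        simp only [Int.cast_natCast] at h2
        simp [longFactor, coord, h2])
    refine key.trans_eq (congrArg _ ?_)
    ext l
    have : ((μ i - μ j).toNat : ℤ) = μ i - μ j := Int.toNat_of_nonneg (by lia)
    simp only [Pi.sub_apply, nsmul_eq_mul, wt, Sum.elim_inl, eps, Function.comp,
      Equiv.swap_apply_def]
    split_ifs <;> simp_all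
  have aux' : ∀ μ : Weight n, mult V μ ≤ mult V (μ ∘ Equiv.swap i j) := by
    intro μ
    rcases le_total (μ j) (μ i) with h | h
    · exact aux i j hij μ h
    · rw [Equiv.swap_comm]; exact aux j i hij.symm μ h
  refine le_antisymm ?_ (aux' μ)
  refine (aux' _).trans_eq ?_
  congr 1; ext l; simp

lemma mult_comp_perm [FiniteDimensional ℂ V] (σ : Equiv.Perm (Fin n)) (μ : Weight n) :
    mult V (μ ∘ σ) = mult V μ := by
  induction σ using Equiv.Perm.swap_induction_on generalizing μ with
  | one => rfl
  | swap_mul σ i j _ ih =>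
    rw [Equiv.Perm.coe_mul, ← Function.comp_assoc, ih, mult_comp_swap]

lemma mult_update_neg [FiniteDimensional ℂ V] (μ : Weight n) (i : Fin n) :
    mult V (Function.update μ i (-μ i)) = mult V μ := by
  have aux : ∀ μ : Weight n, mult V μ ≤ mult V (Function.update μ i (-μ i)) := by
    intro μ
    rcases le_total 0 (μ i) with h | h
    · have h2 : (((μ i).toNat : ℤ) : ℚ) = ((μ i : ℤ) : ℚ) := by rw [Int.toNat_of_nonneg h]
      simp only [Int.cast_natCast] at h2
      have key := mult_le_mult_sub (V := V) (a := .inl i) (b := .inr i) (by simp) (c := 1 / 2)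
        (μ := μ) (k := (μ i).toNat) (by
          simp [longFactor, coord, wt, eps]; norm_num) (by
          simp [longFactor, coord, h2]; ring)
      refine key.trans_eq (congrArg _ ?_)
      ext l
      rcases eq_or_ne l i with rfl | hl
      · simp [wt, eps, h]
      · simp [wt, eps, hl]
    · have h' : 0 ≤ -μ i := by lia
      have h2 : (((-μ i).toNat : ℤ) : ℚ) = ((-μ i : ℤ) : ℚ) := by rw [Int.toNat_of_nonneg h']
      simp only [Int.cast_natCast] at h2
      have key := mult_le_mult_sub (V := V) (a := .inr i) (b := .inl i) (by simp) (c := 1 / 2)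
        (μ := μ) (k := (-μ i).toNat) (by
          simp [longFactor, coord, wt, eps]; norm_num) (by
          simp [longFactor, coord, h2]; ring)
      refine key.trans_eq (congrArg _ ?_)
      ext l
      rcases eq_or_ne l i with rfl | hl
      · simp [wt, eps, h]; ring
      · simp [wt, eps, hl]
  refine le_antisymm ((aux _).trans_eq ?_) (aux μ)
  simp

lemma mult_units_mul [FiniteDimensional ℂ V] (s : Fin n → ℤˣ) (μ : Weight n) :
    mult V (fun i => (s i : ℤ) * μ i) = mult V μ := by
  classical
  have aux : ∀ T : Finset (Fin n), mult V (fun i => if i ∈ T then (s i : ℤ) * μ i else μ i) =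
      mult V μ := by
    intro T
    induction T using Finset.induction_on with
    | empty => simp
    | insert j T hj ih =>
      rw [← ih]
      rcases Int.units_eq_one_or (s j) with h | h
      · congr 1; ext i
        rcases eq_or_ne i j with rfl | hi
        · simp [hj, h]
        · simp [hi]
      · rw [← mult_update_neg (fun i => if i ∈ T then (s i : ℤ) * μ i else μ i) j]
        congr 1; ext i
        rcases eq_or_ne i j with rfl | hi
        · simp [hj, h]
        · simp [hi]
  simpa using aux Finset.univ

end WeylInvariance

/-! ### The Casimir operator and traces on weight spaces -/

section Casimir

open Matrix

variable {n : ℕ} (V : Type) [AddCommGroup V] [Module ℂ V] [LieRingModule (Sp n) V]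
  [LieModule ℂ (Sp n) V]

/-- The Casimir operator, normalized as a sum over pairs of signed indices. -/
def casimir : Module.End ℂ V :=
  ∑ a, ∑ b, LieModule.toEnd ℂ (Sp n) V (rootVec a b) * LieModule.toEnd ℂ (Sp n) V (rootVec b a)

lemma toEnd_mul_casimir (y : Sp n) :
    LieModule.toEnd ℂ (Sp n) V y * casimir (n := n) V =
      casimir (n := n) V * LieModule.toEnd ℂ (Sp n) V y := by
  let φ := LieModule.toEnd ℂ (Sp n) V
  let f : Matrix (Fin n ⊕ Fin n) (Fin n ⊕ Fin n) ℂ →ₗ[ℂ] Module.End ℂ V :=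
    (φ : Sp n →ₗ[ℂ] Module.End ℂ V) ∘ₗ spProj
  have key := sum_bilin_lie_single ((LinearMap.mul ℂ (Module.End ℂ V)).compl₁₂ f f) y.1
  have hf : ∀ X, f (y.1 * X - X * y.1) = φ y * f X - f X * φ y := by
    intro X
    change φ (spProj _) = φ y * φ (spProj X) - φ (spProj X) * φ y
    rw [← lie_spProj, LieHom.map_lie, Ring.lie_def]
  rw [← sub_eq_zero, ← key, casimir]
  simp only [Finset.mul_sum, Finset.sum_mul, ← Finset.sum_sub_distrib]
  refine Finset.sum_congr rfl fun a _ => Finset.sum_congr rfl fun b _ => ?_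
  rw [LinearMap.compl₁₂_apply, LinearMap.compl₁₂_apply, hf, hf, LinearMap.mul_apply',
    LinearMap.mul_apply']
  change φ y * (f _ * f _) - f _ * f _ * φ y = _
  noncomm_ring

lemma exists_casimir_eq_smul [FiniteDimensional ℂ V] [LieModule.IsIrreducible ℂ (Sp n) V] :
    ∃ c : ℂ, ∀ v : V, casimir (n := n) V v = c • v := by
  have := LieModule.nontrivial_of_isIrreducible ℂ (Sp n) V
  obtain ⟨c, hc⟩ := Module.End.exists_eigenvalue (casimir (n := n) V)
  refine ⟨c, fun v => ?_⟩
  let N : LieSubmodule ℂ (Sp n) V :=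
    { __ := Module.End.eigenspace (casimir (n := n) V) c
      lie_mem := by
        intro y w hw
        change w ∈ Module.End.eigenspace (casimir (n := n) V) c at hw
        change ⁅y, w⁆ ∈ Module.End.eigenspace (casimir (n := n) V) c
        rw [Module.End.mem_eigenspace_iff] at hw ⊢
        have h := LinearMap.congr_fun (toEnd_mul_casimir V y) w
        simp only [Module.End.mul_apply, LieModule.toEnd_apply_apply] at h
        rw [← h, hw, lie_smul] }
  have hN : N = ⊤ := by
    refine (eq_bot_or_eq_top N).resolve_left fun h => ?_
    obtain ⟨u, hu⟩ := hc.exists_hasEigenvector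
    have hu' : u ∈ N := hu.1
    rw [h] at hu'
    exact hu.2 (by simpa using hu')
  have hv : v ∈ N := by rw [hN]; trivial
  exact Module.End.mem_eigenspace_iff.1 hv

lemma rootVec_mul_rootVec_mem (a b : Fin n ⊕ Fin n) (μ : Weight n) :
    ∀ v ∈ weightSpace V μ,
      (LieModule.toEnd ℂ (Sp n) V (rootVec a b) * LieModule.toEnd ℂ (Sp n) V (rootVec b a)) v ∈
        weightSpace V μ := by
  intro v hv
  have h := rootVec_lie_mem a b (rootVec_lie_mem b a hv)
  rwa [show μ + (wt b - wt a) + (wt a - wt b) = μ by abel] at h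

/-- The trace of `X_{ab} X_{ba}` on a weight space. -/
def loopTrace (a b : Fin n ⊕ Fin n) (μ : Weight n) : ℂ :=
  LinearMap.trace ℂ (weightSpace V μ) (LinearMap.restrict _ (rootVec_mul_rootVec_mem V a b μ))

variable [FiniteDimensional ℂ V]

/-- Cyclicity of the trace for the two maps between `V_μ` and `V_{μ - α}`. Combined with
`loopTrace_sub` this is Freudenthal's recursion. -/
lemma loopTrace_comm (a b : Fin n ⊕ Fin n) (μ : Weight n) :
    loopTrace V a b μ = loopTrace V b a (μ - (wt a - wt b)) := by
  let f : weightSpace V μ →ₗ[ℂ] weightSpace V (μ - (wt a - wt b)) :=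
    (LieModule.toEnd ℂ (Sp n) V (rootVec b a)).restrict fun v hv => by
      have h := rootVec_lie_mem b a hv
      rwa [show μ + (wt b - wt a) = μ - (wt a - wt b) by abel] at h
  let g : weightSpace V (μ - (wt a - wt b)) →ₗ[ℂ] weightSpace V μ :=
    (LieModule.toEnd ℂ (Sp n) V (rootVec a b)).restrict fun v hv => by
      have h := rootVec_lie_mem a b hv
      rwa [show μ - (wt a - wt b) + (wt a - wt b) = μ by abel] at h
  exact LinearMap.trace_comp_comm' f g

lemma trace_smul_id (c : ℂ) (μ : Weight n) :
    LinearMap.trace ℂ (weightSpace V μ) (c • LinearMap.id) = c * mult V μ := by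
  rw [map_smul, LinearMap.trace_id, smul_eq_mul, mult]

lemma loopTrace_sub {a b : Fin n ⊕ Fin n} (hab : a ≠ b) (μ : Weight n) :
    loopTrace V a b μ - loopTrace V b a μ =
      ((longFactor a b * (coord μ a - coord μ b) : ℤ) : ℂ) * mult V μ := by
  rw [loopTrace, loopTrace, ← map_sub, ← trace_smul_id]
  congr 1
  ext ⟨v, hv⟩
  have h := congrArg (fun x : Sp n => ⁅x, v⁆) (lie_rootVec_rootVec hab)
  simp only [lie_lie, smul_lie, sub_lie, rootVec_self_lie _ hv, ← sub_smul, smul_smul] at h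
  simp only [LinearMap.sub_apply, AddSubgroupClass.coe_sub, LinearMap.coe_restrict_apply,
    Module.End.mul_apply, LieModule.toEnd_apply_apply, LinearMap.smul_apply, LinearMap.id_apply,
    SetLike.val_smul]
  rw [h]
  push_cast; rfl

lemma loopTrace_self (a : Fin n ⊕ Fin n) (μ : Weight n) :
    loopTrace V a a μ = ((coord μ a ^ 2 : ℤ) : ℂ) * mult V μ := by
  rw [loopTrace, ← trace_smul_id]
  congr 1
  ext ⟨v, hv⟩
  simp only [LinearMap.coe_restrict_apply, Module.End.mul_apply, LieModule.toEnd_apply_apply,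
    LinearMap.smul_apply, LinearMap.id_apply, SetLike.val_smul, rootVec_self_lie _ hv, lie_smul,
    smul_smul]
  push_cast; rw [sq]

lemma sum_loopTrace {c : ℂ} (hc : ∀ v : V, casimir (n := n) V v = c • v) (μ : Weight n) :
    ∑ a, ∑ b, loopTrace V a b μ = c * mult V μ := by
  simp only [loopTrace, ← map_sum]
  rw [← trace_smul_id]
  congr 1
  ext ⟨v, hv⟩
  have h := hc v
  simp only [casimir, LinearMap.sum_apply] at h
  simp only [LinearMap.sum_apply, AddSubmonoidClass.coe_finsetSum, LinearMap.coe_restrict_apply,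
    LinearMap.smul_apply, LinearMap.id_apply, SetLike.val_smul]
  exact h

lemma loopTrace_eq_zero {a b : Fin n ⊕ Fin n} {μ : Weight n} (h : mult V μ = 0) :
    loopTrace V a b μ = 0 := by
  have : Subsingleton (weightSpace V μ) := Module.finrank_zero_iff.1 h
  rw [loopTrace, Subsingleton.elim (LinearMap.restrict _ (rootVec_mul_rootVec_mem V a b μ)) 0,
    map_zero]

end Casimir

/-! ### Differential operators on the group algebra -/

section GroupAlgebra

open AddMonoidAlgebra
open scoped Matrix

variable {n : ℕ}

/-- The operator multiplying `e^μ` by `g μ`. -/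
def scale (g : Weight n → K) : GroupAlg n →+ GroupAlg n where
  toFun f := ofCoeff (Finsupp.onFinset f.coeff.support (fun μ => g μ * f.coeff μ) (by
    intro μ h; rw [Finsupp.mem_support_iff]; exact right_ne_zero_of_mul h))
  map_zero' := by ext; simp
  map_add' f f' := by ext; simp [mul_add]

lemma coeff_scale (g : Weight n → K) (f : GroupAlg n) (μ : Weight n) :
    (scale g f).coeff μ = g μ * f.coeff μ := by simp [scale]

lemma scale_single (g : Weight n → K) (μ : Weight n) (c : K) :
    scale g (single μ c) = single μ (g μ * c) := by
  ext ν
  rw [coeff_scale]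
  by_cases h : μ = ν
  · subst h; simp
  · simp [coeff_single, h]

/-- The partial derivative `e^μ ↦ μ_i e^μ`. -/
def pderiv (i : Fin n) : GroupAlg n →+ GroupAlg n := scale fun μ => (μ i : K)

/-- The Laplacian `e^μ ↦ (μ, μ) e^μ`. -/
def laplacian : GroupAlg n →+ GroupAlg n := scale fun μ => ((μ ⬝ᵥ μ : ℤ) : K)

lemma pderiv_mul (i : Fin n) (f g : GroupAlg n) :
    pderiv i (f * g) = pderiv i f * g + f * pderiv i g := by
  induction f using AddMonoidAlgebra.induction_linear with
  | zero => simp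
  | add f₁ f₂ h₁ h₂ => rw [add_mul, map_add, h₁, h₂, map_add]; ring
  | single μ a =>
    induction g using AddMonoidAlgebra.induction_linear with
    | zero => simp
    | add f₁ f₂ h₁ h₂ => rw [mul_add, map_add, h₁, h₂, map_add]; ring
    | single ν b =>
      simp only [pderiv, single_mul_single, scale_single, ← single_add]
      congr 1
      simp only [Pi.add_apply]
      push_cast; ring

lemma laplacian_mul (f g : GroupAlg n) :
    laplacian (f * g) = laplacian f * g + 2 * ∑ i, pderiv i f * pderiv i g + f * laplacian g := by
  induction f using AddMonoidAlgebra.induction_linear with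
  | zero => simp
  | add f₁ f₂ h₁ h₂ =>
    simp only [add_mul, map_add, h₁, h₂, Finset.sum_add_distrib]; ring
  | single μ a =>
    induction g using AddMonoidAlgebra.induction_linear with
    | zero => simp
    | add f₁ f₂ h₁ h₂ => simp only [mul_add, map_add, h₁, h₂, Finset.sum_add_distrib]; ring
    | single ν b =>
      have hsum : ∀ g : Fin n → K, ∑ i, single (μ + ν) (g i) =
          (single (μ + ν) (∑ i, g i) : GroupAlg n) := fun g =>
        (map_sum (AddMonoidHom.mk' (fun c : K => (single (μ + ν) c : GroupAlg n))
          (fun c d => single_add _ c d)) g _).symm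
      simp only [laplacian, pderiv, single_mul_single, scale_single, hsum, two_mul, ← single_add]
      congr 1
      simp only [add_dotProduct, dotProduct_add, dotProduct_comm ν μ]
      have : ∑ i, (μ i : K) * a * ((ν i : K) * b) = ((μ ⬝ᵥ ν : ℤ) : K) * (a * b) := by
        simp only [dotProduct, Int.cast_sum, Int.cast_mul, Finset.sum_mul]
        exact Finset.sum_congr rfl fun i _ => by ring
      rw [this]
      push_cast; ring

/-- The logarithmic derivative of a product. -/
lemma algebraMap_pderiv_prod {ι : Type*} (i : Fin n) (S : Finset ι) (f : ι → GroupAlg n)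
    (hf : ∀ s ∈ S, algebraMap (GroupAlg n) (Frac n) (f s) ≠ 0) :
    algebraMap (GroupAlg n) (Frac n) (pderiv i (∏ s ∈ S, f s)) =
      algebraMap (GroupAlg n) (Frac n) (∏ s ∈ S, f s) *
        ∑ s ∈ S, algebraMap (GroupAlg n) (Frac n) (pderiv i (f s)) /
          algebraMap (GroupAlg n) (Frac n) (f s) := by
  classical
  induction S using Finset.induction_on with
  | empty =>
    simp [pderiv, one_def, scale_single]
  | insert s S hs ih =>
    have h0 := hf s (Finset.mem_insert_self s S)
    rw [Finset.prod_insert hs, Finset.sum_insert hs, pderiv_mul, map_add, map_mul, map_mul, map_mul,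
      ih fun t ht => hf t (Finset.mem_insert_of_mem ht)]
    field_simp

lemma expo_add (μ ν : Weight n) : expo (μ + ν) = expo μ * expo ν := by
  rw [expo, expo, expo, ← map_mul, single_mul_single, one_mul]

lemma expo_zero : expo (0 : Weight n) = 1 := by
  rw [expo, ← one_def, map_one]

lemma expo_ne_zero (μ : Weight n) : expo μ ≠ 0 := by
  have h := expo_add μ (-μ)
  rw [add_neg_cancel, expo_zero] at h
  exact left_ne_zero_of_mul_eq_one h.symm

lemma expo_neg (μ : Weight n) : expo (-μ) = (expo μ)⁻¹ := by
  have h := expo_add μ (-μ)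
  rw [add_neg_cancel, expo_zero] at h
  exact (inv_eq_of_mul_eq_one_right h.symm).symm

lemma expo_sub (μ ν : Weight n) : expo (μ - ν) = expo μ / expo ν := by
  rw [sub_eq_add_neg, expo_add, expo_neg, div_eq_mul_inv]

lemma expo_zsmul (m : ℤ) (μ : Weight n) : expo (m • μ) = expo μ ^ m := by
  let f : Multiplicative (Weight n) →* (Frac n) :=
    { toFun := fun μ => expo μ.toAdd, map_one' := expo_zero, map_mul' := fun _ _ => expo_add _ _ }
  exact map_zpow' f (fun μ => expo_neg μ.toAdd) (Multiplicative.ofAdd μ) m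

lemma expo_injective : Function.Injective (expo (n := n)) := by
  intro μ ν h
  have := IsFractionRing.injective (GroupAlg n) (Frac n) h
  exact single_left_injective one_ne_zero this

/-- The variables `x_i = e^{ε_i}`. -/
def xvar (n : ℕ) (i : Fin n) : Frac n := expo (eps i)

lemma xvar_ne_zero (i : Fin n) : xvar n i ≠ 0 := expo_ne_zero _

lemma xvar_sub_inv_ne_zero (i : Fin n) : xvar n i - (xvar n i)⁻¹ ≠ 0 := by
  rw [xvar, ← expo_neg, sub_ne_zero]
  intro h
  have := congrFun (expo_injective h) i
  simp [eps] at this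

lemma xvar_sub_ne_zero {i j : Fin n} (hij : i ≠ j) : xvar n i - xvar n j ≠ 0 := by
  rw [xvar, xvar, sub_ne_zero]
  intro h
  have := congrFun (expo_injective h) i
  simp [eps, hij] at this

lemma xvar_sub_inv_ne_zero' {i j : Fin n} (hij : i ≠ j) : xvar n i - (xvar n j)⁻¹ ≠ 0 := by
  rw [xvar, xvar, ← expo_neg, sub_ne_zero]
  intro h
  have := congrFun (expo_injective h) i
  simp [eps, hij] at this

lemma xvar_diff_ne_zero {i j : Fin n} (hij : i ≠ j) :
    xvar n i + (xvar n i)⁻¹ - (xvar n j + (xvar n j)⁻¹) ≠ 0 := by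
  have h1 := xvar_sub_ne_zero hij
  have h2 := xvar_sub_inv_ne_zero' hij
  have hi := xvar_ne_zero i
  have hj := xvar_ne_zero j
  have : xvar n i + (xvar n i)⁻¹ - (xvar n j + (xvar n j)⁻¹) =
      (xvar n i - xvar n j) * (xvar n i - (xvar n j)⁻¹) / xvar n i := by
    field_simp
    ring
  rw [this]
  exact div_ne_zero (mul_ne_zero h1 h2) hi

lemma weylDenom_xvar_ne_zero : weylDenom (xvar n) ≠ 0 :=
  mul_ne_zero (Finset.prod_ne_zero_iff.2 fun i _ => xvar_sub_inv_ne_zero i)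
    (Finset.prod_ne_zero_iff.2 fun _ _ => Finset.prod_ne_zero_iff.2 fun _ hj =>
      xvar_diff_ne_zero (Finset.mem_Ioi.1 hj).ne)

/-- The Weyl denominator in the group algebra. -/
def denomAlg (n : ℕ) : GroupAlg n :=
  (∏ i, (single (eps i) 1 - single (-eps i) 1)) * ∏ i, ∏ j ∈ Finset.Ioi i,
    (single (eps i) 1 + single (-eps i) 1 - (single (eps j) 1 + single (-eps j) 1))

lemma algebraMap_single_eps (i : Fin n) :
    algebraMap (GroupAlg n) (Frac n) (single (eps i) 1) = xvar n i := rfl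

lemma algebraMap_single_neg_eps (i : Fin n) :
    algebraMap (GroupAlg n) (Frac n) (single (-eps i) 1) = (xvar n i)⁻¹ := expo_neg _

lemma algebraMap_denomAlg : algebraMap (GroupAlg n) (Frac n) (denomAlg n) = weylDenom (xvar n) := by
  simp only [denomAlg, weylDenom, map_mul, map_prod, map_sub, map_add, algebraMap_single_eps,
    algebraMap_single_neg_eps]

lemma pderiv_single_eps (p i : Fin n) :
    pderiv p (single (eps i) 1) = if i = p then single (eps i) 1 else 0 := by
  rw [pderiv, scale_single]
  split_ifs with h
  · simp [eps, h]
  · simp [eps, Ne.symm h]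

lemma pderiv_single_neg_eps (p i : Fin n) :
    pderiv p (single (-eps i) 1) = if i = p then -single (-eps i) 1 else 0 := by
  rw [pderiv, scale_single]
  split_ifs with h
  · simp [eps, h]
  · simp [eps, Ne.symm h]

/-- The logarithmic derivative of the Weyl denominator. -/
def logDeriv (p : Fin n) : Frac n :=
  (xvar n p + (xvar n p)⁻¹) / (xvar n p - (xvar n p)⁻¹) +
    ∑ j ∈ Finset.univ.erase p, (xvar n p - (xvar n p)⁻¹) /
      (xvar n p + (xvar n p)⁻¹ - (xvar n j + (xvar n j)⁻¹))

lemma algebraMap_pderiv_denomAlg (p : Fin n) :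
    algebraMap (GroupAlg n) (Frac n) (pderiv p (denomAlg n)) =
      weylDenom (xvar n) * logDeriv p := by
  have h1 := algebraMap_pderiv_prod p Finset.univ
    (fun i : Fin n => (single (eps i) 1 - single (-eps i) 1 : GroupAlg n)) (fun i _ => by
      simpa only [map_sub, algebraMap_single_eps, algebraMap_single_neg_eps] using
        xvar_sub_inv_ne_zero i)
  have h2 : ∀ i : Fin n, _ := fun i => algebraMap_pderiv_prod p (Finset.Ioi i)
    (fun j : Fin n => (single (eps i) 1 + single (-eps i) 1 -
      (single (eps j) 1 + single (-eps j) 1) : GroupAlg n)) (fun j hj => by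
      simpa only [map_sub, map_add, algebraMap_single_eps, algebraMap_single_neg_eps] using
        xvar_diff_ne_zero (Finset.mem_Ioi.1 hj).ne)
  have hne : ∀ i : Fin n, algebraMap (GroupAlg n) (Frac n) (∏ j ∈ Finset.Ioi i,
      (single (eps i) 1 + single (-eps i) 1 - (single (eps j) 1 + single (-eps j) 1))) ≠ 0 := by
    intro i
    simp only [map_prod, map_sub, map_add, algebraMap_single_eps, algebraMap_single_neg_eps]
    exact Finset.prod_ne_zero_iff.2 fun j hj => xvar_diff_ne_zero (Finset.mem_Ioi.1 hj).ne
  have h3 := algebraMap_pderiv_prod p Finset.univ (fun i : Fin n => ∏ j ∈ Finset.Ioi i,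
      (single (eps i) 1 + single (-eps i) 1 - (single (eps j) 1 + single (-eps j) 1) :
        GroupAlg n)) (fun i _ => hne i)
  simp only [h2, mul_div_cancel_left₀ _ (hne _)] at h3
  rw [← algebraMap_denomAlg, denomAlg, pderiv_mul, map_add, map_mul, map_mul, h1, h3, map_mul]
  have key : ∀ A B x y z : Frac n, x + y = z → A * x * B + A * (B * y) = A * B * z := by
    intro A B x y z h; rw [← h]; ring
  refine key _ _ _ _ _ ?_
  simp only [map_sub, map_add, pderiv_single_eps, pderiv_single_neg_eps, apply_ite (algebraMap _ _),
    map_zero, map_neg, algebraMap_single_eps, algebraMap_single_neg_eps]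
  rw [logDeriv]
  congr 1
  · rw [Finset.sum_eq_single p]
    · simp
    · intro i _ hi; simp [hi]
    · simp
  -- The factor for `i < j` depends on `x_p` only if `i = p` or `j = p`; in the second case
  -- numerator and denominator both change sign.
  · have hterm : ∀ i : Fin n, ∑ j ∈ Finset.Ioi i,
        (((if i = p then xvar n i else 0) + if i = p then -(xvar n i)⁻¹ else 0) -
          ((if j = p then xvar n j else 0) + if j = p then -(xvar n j)⁻¹ else 0)) /
            (xvar n i + (xvar n i)⁻¹ - (xvar n j + (xvar n j)⁻¹)) =
        (if i = p then ∑ j ∈ Finset.Ioi p, (xvar n p - (xvar n p)⁻¹) /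
            (xvar n p + (xvar n p)⁻¹ - (xvar n j + (xvar n j)⁻¹)) else 0) +
          if i < p then (xvar n p - (xvar n p)⁻¹) /
            (xvar n p + (xvar n p)⁻¹ - (xvar n i + (xvar n i)⁻¹)) else 0 := by
      intro i
      by_cases hip : i = p
      · subst hip
        simp only [if_true, lt_irrefl, if_false, add_zero]
        refine Finset.sum_congr rfl fun j hj => ?_
        rw [if_neg (Finset.mem_Ioi.1 hj).ne', if_neg (Finset.mem_Ioi.1 hj).ne']
        ring
      · simp only [if_neg hip, zero_add]
        by_cases h : i < p
        · rw [if_pos h, Finset.sum_eq_single p]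
          · rw [if_pos rfl, if_pos rfl, ← neg_div_neg_eq]
            congr 1 <;> ring
          · intro j _ hj; simp [hj]
          · intro h'; exact absurd (Finset.mem_Ioi.2 h) h'
        · rw [if_neg h]
          refine Finset.sum_eq_zero fun j hj => ?_
          have : j ≠ p := by rintro rfl; exact h (Finset.mem_Ioi.1 hj)
          simp [this]
    have h5 : Finset.univ.erase p = Finset.Ioi p ∪ Finset.univ.filter (· < p) := by
      ext a; simp [lt_or_lt_iff_ne]; tauto
    rw [Finset.sum_congr rfl fun i _ => hterm i, Finset.sum_add_distrib, Finset.sum_ite_eq',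
      if_pos (Finset.mem_univ p), ← Finset.sum_filter, h5, Finset.sum_union]
    exact Finset.disjoint_left.2 fun a h h' =>
      lt_asymm (Finset.mem_Ioi.1 h) (Finset.mem_filter.1 h').2

end GroupAlgebra

/-! ### The Laplace equation of a character -/

section Laplace

open AddMonoidAlgebra
open scoped Matrix

variable {n : ℕ}

lemma sum_erase_sum {M : Type*} [AddCommMonoid M] (f : Fin n ⊕ Fin n → M) (a : Fin n ⊕ Fin n)
    (i : Fin n) (ha : a = .inl i ∨ a = .inr i) :
    ∑ b ∈ Finset.univ.erase a, f b =
      f a.swap + ∑ j ∈ Finset.univ.erase i, (f (.inl j) + f (.inr j)) := by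
  have h : Finset.univ.erase a = insert a.swap
      ((Finset.univ.erase i).disjSum (Finset.univ.erase i)) := by
    ext (b | b) <;> rcases ha with rfl | rfl <;> simp
    all_goals tauto
  rw [h, Finset.sum_insert (by rcases ha with rfl | rfl <;> simp), Finset.sum_disjSum,
    Finset.sum_add_distrib]

lemma expo_wt_inl (i : Fin n) : expo (wt (.inl i)) = xvar n i := rfl

lemma expo_wt_inr (i : Fin n) : expo (wt (.inr i)) = (xvar n i)⁻¹ := expo_neg _

lemma expo_wt_injective : Function.Injective fun a : Fin n ⊕ Fin n => expo (wt a) := by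
  intro a b h
  by_contra hab
  have h0 : wt a - wt b = 0 := sub_eq_zero.2 (expo_injective h)
  rcases wt_sub_wt_mem hab with h' | h'
  · have := dotProduct_rho_pos h'
    rw [h0, zero_dotProduct] at this
    exact lt_irrefl _ this
  · have := dotProduct_rho_pos h'
    rw [← neg_sub, h0, neg_zero, zero_dotProduct] at this
    exact lt_irrefl _ this

/-- It merges the contributions of the indices `j` and `-j` into one summand of `logDeriv`. -/
lemma div_sub_add_div_sub_inv {F : Type*} [Field F] {x y : F} (hx : x ≠ 0) (hy : y ≠ 0)
    (h1 : y - x ≠ 0) (h2 : y - x⁻¹ ≠ 0) :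
    (y + x) / (y - x) + (y + x⁻¹) / (y - x⁻¹) =
      2 * ((y - y⁻¹) / (y + y⁻¹ - (x + x⁻¹))) := by
  have h3 : y + y⁻¹ - (x + x⁻¹) = (y - x) * (y - x⁻¹) * y⁻¹ := by
    field_simp; ring
  rw [h3, div_add_div _ _ h1 h2, mul_div_assoc', div_eq_div_iff (mul_ne_zero h1 h2)
    (mul_ne_zero (mul_ne_zero h1 h2) (inv_ne_zero hy))]
  field_simp
  ring

/-- The logarithmic derivative as a sum over the roots that involve a signed index. -/
lemma sum_longFactor_mul (a : Fin n ⊕ Fin n) (i : Fin n) (ε : ℤˣ)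
    (ha : (a = .inl i ∧ ε = 1) ∨ (a = .inr i ∧ ε = -1)) :
    ∑ b ∈ Finset.univ.erase a, (longFactor a b : Frac n) *
      ((expo (wt a) + expo (wt b)) / (expo (wt a) - expo (wt b))) =
        2 * (((ε : ℤ) : Frac n) * logDeriv i) := by
  have hxi := xvar_ne_zero i
  have hdi := xvar_sub_inv_ne_zero i
  have ha' : a = .inl i ∨ a = .inr i := by tauto
  have hterm : ∀ j ∈ Finset.univ.erase i,
      (longFactor a (.inl j) : Frac n) *
        ((expo (wt a) + expo (wt (.inl j))) / (expo (wt a) - expo (wt (.inl j)))) +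
      (longFactor a (.inr j) : Frac n) *
        ((expo (wt a) + expo (wt (.inr j))) / (expo (wt a) - expo (wt (.inr j)))) =
      2 * (((ε : ℤ) : Frac n) * ((xvar n i - (xvar n i)⁻¹) /
        (xvar n i + (xvar n i)⁻¹ - (xvar n j + (xvar n j)⁻¹)))) := by
    intro j hj
    have hji := Finset.ne_of_mem_erase hj
    have e1 : longFactor a (.inl j) = 1 := by
      rcases ha' with rfl | rfl <;> simp [longFactor, hji]
    have e2 : longFactor a (.inr j) = 1 := by
      rcases ha' with rfl | rfl <;> simp [longFactor, hji]
    have h1 : expo (wt a) - expo (wt (.inl j)) ≠ 0 := sub_ne_zero.2 (expo_wt_injective.ne (by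
      rcases ha' with rfl | rfl <;> simp [hji.symm]))
    have h2 : expo (wt a) - expo (wt (.inr j)) ≠ 0 := sub_ne_zero.2 (expo_wt_injective.ne (by
      rcases ha' with rfl | rfl <;> simp [hji.symm]))
    rw [expo_wt_inl] at h1
    rw [expo_wt_inr] at h2
    rw [e1, e2, expo_wt_inl, expo_wt_inr, Int.cast_one, one_mul, one_mul,
      div_sub_add_div_sub_inv (xvar_ne_zero j) (expo_ne_zero _) h1 h2]
    rcases ha with ⟨rfl, rfl⟩ | ⟨rfl, rfl⟩
    · rw [expo_wt_inl]; simp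
    · rw [expo_wt_inr, inv_inv, add_comm (xvar n i)⁻¹]
      push_cast; ring
  rw [sum_erase_sum _ a i ha', Finset.sum_congr rfl hterm, ← Finset.mul_sum, ← Finset.mul_sum,
    logDeriv]
  have hsw : (longFactor a a.swap : Frac n) * ((expo (wt a) + expo (wt a.swap)) /
      (expo (wt a) - expo (wt a.swap))) = 2 * (((ε : ℤ) : Frac n) *
        ((xvar n i + (xvar n i)⁻¹) / (xvar n i - (xvar n i)⁻¹))) := by
    rcases ha with ⟨rfl, rfl⟩ | ⟨rfl, rfl⟩
    · simp [longFactor, expo_wt_inl, expo_wt_inr]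
    · simp only [longFactor, Sum.swap_inr, if_true, expo_wt_inl, expo_wt_inr]
      rw [← neg_sub (xvar n i), div_neg]
      push_cast; ring
  rw [hsw]
  ring

variable (V : Type) [AddCommGroup V] [Module ℂ V] [LieRingModule (Sp n) V]
  [LieModule ℂ (Sp n) V] [FiniteDimensional ℂ V]

/-- The set of weights of a module. -/
def weights : Finset (Weight n) := (finite_support_mult (n := n) V).toFinset

lemma mem_weights {μ : Weight n} : μ ∈ weights V ↔ mult V μ ≠ 0 := by
  simp [weights]

/-- The element of the group algebra with given coefficients at the weights of a module. -/
def weightSum (f : Weight n → K) : GroupAlg n := ∑ μ ∈ weights V, single μ (f μ)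

lemma coeff_weightSum {f : Weight n → K} (hf : ∀ μ : Weight n, mult V μ = 0 → f μ = 0)
    (μ : Weight n) : (weightSum V f).coeff μ = f μ := by
  classical
  rw [weightSum, coeff_sum, Finsupp.finsetSum_apply]
  simp only [coeff_single, Finsupp.single_apply, Finset.sum_ite_eq']
  split_ifs with h
  · rfl
  · rw [mem_weights, not_not] at h
    exact (hf μ h).symm

/-- The character as an element of the group algebra. -/
def charAlg : GroupAlg n := weightSum V fun μ => (mult V μ : K)

lemma coeff_charAlg (μ : Weight n) : (charAlg V).coeff μ = mult V μ :=
  coeff_weightSum V (fun μ h => by rw [h, Nat.cast_zero]) μ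

lemma character_eq : character (n := n) V = algebraMap (GroupAlg n) (Frac n) (charAlg V) := by
  rw [character, charAlg, weightSum, map_sum, finsum_eq_sum_of_support_subset (s := weights V)]
  · refine Finset.sum_congr rfl fun μ _ => ?_
    have : (single μ (mult V μ : K) : GroupAlg n) = (mult V μ : GroupAlg n) * single μ 1 := by
      rw [natCast_def, single_mul_single]; simp
    rw [this, map_mul, map_natCast]
    rfl
  · intro μ hμ
    rw [Finset.mem_coe, mem_weights]
    intro h
    apply hμ
    change ((mult V μ : ℕ) : Frac n) * _ = 0
    rw [h, Nat.cast_zero, zero_mul]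

/-- The generating function of the traces `loopTrace V a b`. -/
def loopAlg (a b : Fin n ⊕ Fin n) : GroupAlg n :=
  weightSum V fun μ => algebraMap ℂ K (loopTrace V a b μ)

lemma coeff_loopAlg (a b : Fin n ⊕ Fin n) (μ : Weight n) :
    (loopAlg V a b).coeff μ = algebraMap ℂ K (loopTrace V a b μ) :=
  coeff_weightSum V (fun μ h => by rw [loopTrace_eq_zero V h, map_zero]) μ

lemma loopAlg_comm (a b : Fin n ⊕ Fin n) :
    loopAlg V a b = single (wt a - wt b) 1 * loopAlg V b a := by
  ext μ
  rw [coeff_single_mul_apply, coeff_loopAlg, coeff_loopAlg, one_mul, loopTrace_comm]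
  congr 3
  abel

/-- The derivative of the character in the direction of a signed index. -/
def charDeriv (a : Fin n ⊕ Fin n) : GroupAlg n := scale (fun μ => (coord μ a : K)) (charAlg V)

lemma charDeriv_inl (i : Fin n) : charDeriv V (.inl i) = pderiv i (charAlg V) := rfl

lemma charDeriv_inr (i : Fin n) : charDeriv V (.inr i) = -pderiv i (charAlg V) := by
  ext μ
  simp [charDeriv, pderiv, coeff_scale, coord]

lemma loopAlg_sub {a b : Fin n ⊕ Fin n} (hab : a ≠ b) :
    loopAlg V a b - loopAlg V b a =
      (longFactor a b : GroupAlg n) * (charDeriv V a - charDeriv V b) := by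
  ext μ
  rw [coeff_sub, Finsupp.sub_apply, coeff_loopAlg, coeff_loopAlg, ← map_sub, loopTrace_sub V hab,
    intCast_def, coeff_single_mul_apply]
  simp only [neg_zero, zero_add, coeff_sub, Finsupp.sub_apply, charDeriv, coeff_scale,
    coeff_charAlg, map_mul, map_intCast, map_natCast]
  push_cast; ring

/-- `loopAlg_comm` and `loopAlg_sub` are two linear equations for `loopAlg V a b` and `loopAlg V b
a`. They are solved by dividing by `e^{wt a} - e^{wt b}`, which is why the fraction field is used.
-/
lemma algebraMap_loopAlg {a b : Fin n ⊕ Fin n} (hab : a ≠ b) :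
    algebraMap (GroupAlg n) (Frac n) (loopAlg V a b) = (longFactor a b : Frac n) *
      (expo (wt a) / (expo (wt a) - expo (wt b)) *
        (algebraMap _ _ (charDeriv V a) - algebraMap _ _ (charDeriv V b))) := by
  have h1 := congrArg (algebraMap (GroupAlg n) (Frac n)) (loopAlg_sub V hab)
  have h2 : algebraMap (GroupAlg n) (Frac n) (loopAlg V b a) =
      expo (wt b) / expo (wt a) * algebraMap (GroupAlg n) (Frac n) (loopAlg V a b) := by
    rw [loopAlg_comm V b a, map_mul, ← expo_sub]; rfl
  have hne : expo (wt a) - expo (wt b) ≠ 0 := sub_ne_zero.2 (expo_wt_injective.ne hab)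
  have ha := expo_ne_zero (wt a)
  rw [map_sub, map_mul, map_intCast, map_sub, h2] at h1
  have h3 : algebraMap (GroupAlg n) (Frac n) (loopAlg V a b) *
      (expo (wt a) - expo (wt b)) = expo (wt a) * ((longFactor a b : Frac n) *
        (algebraMap _ _ (charDeriv V a) - algebraMap _ _ (charDeriv V b))) := by
    rw [← h1]; field_simp
  rw [eq_div_of_mul_eq hne h3]
  ring

lemma longFactor_comm (a b : Fin n ⊕ Fin n) : longFactor a b = longFactor b a := by
  simp only [longFactor]
  congr 1
  rw [eq_iff_iff]
  constructor <;> rintro rfl <;> simp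

/-- Collecting the coefficient of each derivative, `x_a/(x_a - x_b) - x_b/(x_b - x_a) = (x_a +
x_b)/(x_a - x_b)`, and these sum to `2 * logDeriv` up to sign. The indices `i` and `-i` contribute
equally, whence the `4`. -/
lemma sum_loopAlg_offDiag :
    ∑ a : Fin n ⊕ Fin n, ∑ b ∈ Finset.univ.erase a,
      algebraMap (GroupAlg n) (Frac n) (loopAlg V a b) =
        4 * ∑ i, logDeriv i * algebraMap _ _ (pderiv i (charAlg V)) := by
  set d : Fin n ⊕ Fin n → Frac n := fun a => algebraMap (GroupAlg n) (Frac n) (charDeriv V a)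
    with hd
  set x : Fin n ⊕ Fin n → Frac n := fun a => expo (wt a) with hx
  have h1 : ∀ a : Fin n ⊕ Fin n, ∀ b ∈ Finset.univ.erase a,
      algebraMap (GroupAlg n) (Frac n) (loopAlg V a b) =
        longFactor a b * (x a / (x a - x b)) * d a -
          longFactor a b * (x a / (x a - x b)) * d b := by
    intro a b hb
    rw [algebraMap_loopAlg V (Finset.ne_of_mem_erase hb).symm]
    ring
  have h2 : ∑ a : Fin n ⊕ Fin n, ∑ b ∈ Finset.univ.erase a,
      (longFactor a b : Frac n) * (x a / (x a - x b)) * d b =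
      ∑ a : Fin n ⊕ Fin n, ∑ b ∈ Finset.univ.erase a,
        (longFactor a b : Frac n) * (x b / (x b - x a)) * d a := by
    rw [Finset.sum_comm' (t' := Finset.univ) (s' := fun b => Finset.univ.erase b)
      (by intro a b; simp [eq_comm])]
    refine Finset.sum_congr rfl fun a _ => Finset.sum_congr rfl fun b _ => ?_
    rw [longFactor_comm]
  have h3 : ∀ a : Fin n ⊕ Fin n, ∑ b ∈ Finset.univ.erase a,
      ((longFactor a b : Frac n) * (x a / (x a - x b)) * d a -
        (longFactor a b : Frac n) * (x b / (x b - x a)) * d a) =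
      (∑ b ∈ Finset.univ.erase a, (longFactor a b : Frac n) *
        ((x a + x b) / (x a - x b))) * d a := by
    intro a
    rw [Finset.sum_mul]
    refine Finset.sum_congr rfl fun b _ => ?_
    rw [← neg_sub (x a) (x b), div_neg, add_div]
    ring
  rw [Finset.sum_congr rfl fun a _ => Finset.sum_congr rfl (h1 a)]
  simp only [Finset.sum_sub_distrib]
  rw [h2]
  simp only [← Finset.sum_sub_distrib, h3]
  rw [Fintype.sum_sum_type, Finset.mul_sum, ← Finset.sum_add_distrib]
  refine Finset.sum_congr rfl fun i _ => ?_
  simp only [hx, hd]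
  rw [sum_longFactor_mul (.inl i) i 1 (.inl ⟨rfl, rfl⟩),
    sum_longFactor_mul (.inr i) i (-1) (.inr ⟨rfl, rfl⟩), charDeriv_inl, charDeriv_inr, map_neg]
  push_cast; ring

lemma sum_loopAlg_diag :
    ∑ a : Fin n ⊕ Fin n, loopAlg V a a = 2 * laplacian (charAlg V) := by
  ext μ
  rw [coeff_sum, Finsupp.finsetSum_apply, two_mul, coeff_add, Finsupp.add_apply, laplacian,
    coeff_scale, coeff_charAlg, Fintype.sum_sum_type]
  simp only [coeff_loopAlg, loopTrace_self, map_mul, map_intCast, map_natCast, ← Finset.sum_mul,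
    coord, Sum.elim_inl, Sum.elim_inr, neg_sq, dotProduct]
  push_cast
  simp only [sq]

/-- The Casimir equation is `2 Δ ch + 4 D⁻¹ ∑ ∂_i D ∂_i ch = c ch`. The first-order term is exactly
the cross term in `2 Δ(D ch)`, so multiplication by `D` removes it. -/
lemma laplacian_denomAlg_mul_charAlg {c : ℂ} (hc : ∀ v : V, casimir (n := n) V v = c • v)
    {r : ℤ} (hr : laplacian (denomAlg n) = (r : GroupAlg n) * denomAlg n) :
    2 * laplacian (denomAlg n * charAlg V) =
      algebraMap K (GroupAlg n) (algebraMap ℂ K c + 2 * r) * (denomAlg n * charAlg V) := by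
  have hcas : ∑ a : Fin n ⊕ Fin n, ∑ b, loopAlg V a b =
      algebraMap K (GroupAlg n) (algebraMap ℂ K c) * charAlg V := by
    ext μ
    simp only [coeff_sum, Finsupp.finsetSum_apply, coeff_loopAlg, ← map_sum, sum_loopTrace V hc]
    rw [← Algebra.smul_def, coeff_smul_apply, coeff_charAlg, map_mul, map_natCast, smul_eq_mul]
  have hsplit : 2 * laplacian (charAlg V) +
      ∑ a : Fin n ⊕ Fin n, ∑ b ∈ Finset.univ.erase a, loopAlg V a b =
        algebraMap K (GroupAlg n) (algebraMap ℂ K c) * charAlg V := by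
    rw [← hcas, ← sum_loopAlg_diag, ← Finset.sum_add_distrib]
    exact Finset.sum_congr rfl fun a _ => Finset.add_sum_erase _ _ (Finset.mem_univ a)
  have hoff : denomAlg n * ∑ a : Fin n ⊕ Fin n, ∑ b ∈ Finset.univ.erase a, loopAlg V a b =
      4 * ∑ i, pderiv i (denomAlg n) * pderiv i (charAlg V) := by
    apply IsFractionRing.injective (GroupAlg n) (Frac n)
    simp only [map_mul, map_sum, map_ofNat]
    rw [sum_loopAlg_offDiag, algebraMap_denomAlg, mul_left_comm, Finset.mul_sum]
    congr 1
    refine Finset.sum_congr rfl fun i _ => ?_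
    rw [algebraMap_pderiv_denomAlg]
    ring
  rw [laplacian_mul, hr]
  have := congrArg (denomAlg n * ·) hsplit
  simp only [mul_add, hoff] at this
  simp only [map_add, map_mul, map_intCast, map_ofNat]
  linear_combination this

end Laplace

/-! ### The Weyl character formula -/

section CharacterFormula

open AddMonoidAlgebra
open scoped Matrix

variable {n : ℕ}

/-- The action of a signed permutation on weights. -/
def signedPerm (σ : Equiv.Perm (Fin n)) (s : Fin n → ℤˣ) : Weight n ≃ Weight n where
  toFun μ i := (s i : ℤ) * μ (σ i)
  invFun μ i := (s (σ.symm i) : ℤ) * μ (σ.symm i)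
  left_inv μ := by
    ext i
    simp only [Equiv.apply_symm_apply]
    rw [← mul_assoc, ← Units.val_mul, Int.units_mul_self, Units.val_one, one_mul]
  right_inv μ := by
    ext i
    simp only [Equiv.symm_apply_apply]
    rw [← mul_assoc, ← Units.val_mul, Int.units_mul_self, Units.val_one, one_mul]

lemma signedPerm_apply (σ : Equiv.Perm (Fin n)) (s : Fin n → ℤˣ) (μ : Weight n) (i : Fin n) :
    signedPerm σ s μ i = (s i : ℤ) * μ (σ i) := rfl

lemma signedPerm_add (σ : Equiv.Perm (Fin n)) (s : Fin n → ℤˣ) (μ ν : Weight n) :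
    signedPerm σ s (μ + ν) = signedPerm σ s μ + signedPerm σ s ν := by
  ext i; simp [signedPerm_apply, mul_add]

lemma signedPerm_dotProduct_self (σ : Equiv.Perm (Fin n)) (s : Fin n → ℤˣ) (μ : Weight n) :
    signedPerm σ s μ ⬝ᵥ signedPerm σ s μ = μ ⬝ᵥ μ := by
  simp only [dotProduct, signedPerm_apply]
  rw [← Equiv.sum_comp σ fun i => μ i * μ i]
  refine Finset.sum_congr rfl fun i _ => ?_
  rw [mul_mul_mul_comm, ← Units.val_mul, Int.units_mul_self, Units.val_one, one_mul]

lemma exists_signedPerm_isDominant (μ : Weight n) : ∃ σ s, IsDominant (signedPerm σ s μ) := by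
  let σ := Tuple.sort fun i => -|μ i|
  have hσ : Monotone ((fun i => -|μ i|) ∘ σ) := Tuple.monotone_sort _
  refine ⟨σ, fun i => if 0 ≤ μ (σ i) then 1 else -1, ?_⟩
  have h : ∀ i, signedPerm σ (fun i => if 0 ≤ μ (σ i) then 1 else -1) μ i = |μ (σ i)| := by
    intro i
    rw [signedPerm_apply]
    split_ifs with h
    · simp [abs_of_nonneg h]
    · simp [abs_of_neg (not_le.1 h)]
  refine ⟨fun i j hij => ?_, fun i => ?_⟩
  · rw [h, h]
    exact neg_le_neg_iff.1 (hσ hij)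
  · rw [h]; exact abs_nonneg _

/-- The sign of a signed permutation. -/
def signOf (σ : Equiv.Perm (Fin n)) (s : Fin n → ℤˣ) : ℤ := σ.sign * ∏ i, (s i : ℤ)

/-- The alternant in the group algebra. -/
def altAlg (ν : Weight n) : GroupAlg n :=
  ∑ σ : Equiv.Perm (Fin n), ∑ s : Fin n → ℤˣ, single (signedPerm σ s ν) (signOf σ s : K)

lemma single_intCast (μ : Weight n) (c : ℤ) :
    (single μ (c : K) : GroupAlg n) = (c : GroupAlg n) * single μ 1 := by
  rw [intCast_def, single_mul_single]; simp

lemma expo_eq_prod (μ : Weight n) : expo μ = ∏ i, xvar n i ^ μ i := by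
  have h : μ = ∑ i, μ i • eps i := by
    ext j; simp [eps, Finset.sum_apply, Pi.single_apply]
  conv_lhs => rw [h]
  have hs : ∀ S : Finset (Fin n), expo (∑ i ∈ S, μ i • eps i) = ∏ i ∈ S, xvar n i ^ μ i := by
    classical
    intro S
    induction S using Finset.induction_on with
    | empty => simp [expo_zero]
    | insert i S hi ih =>
      rw [Finset.sum_insert hi, Finset.prod_insert hi, expo_add, ih, expo_zsmul, xvar]
  exact hs _

lemma algebraMap_altAlg (ν : Weight n) :
    algebraMap (GroupAlg n) (Frac n) (altAlg ν) = alternant (xvar n) ν := by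
  have hodd : ∀ i j, altMatrix (xvar n) ν i j =
      ∑ s : ℤˣ, ((s : ℤ) : Frac n) * xvar n i ^ ((s : ℤ) * ν j) := by
    intro i j
    rw [UnitsInt.univ, Finset.sum_pair (by decide)]
    simp [altMatrix, oddPow]; ring
  rw [alternant, ← Matrix.det_transpose, Matrix.det_apply', altAlg, map_sum]
  refine Finset.sum_congr rfl fun σ _ => ?_
  simp only [Matrix.transpose_apply, hodd]
  rw [map_sum, Finset.prod_univ_sum, Fintype.piFinset_univ, Finset.mul_sum]
  refine Finset.sum_congr rfl fun s _ => ?_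
  rw [single_intCast, map_mul, map_intCast]
  change _ * expo _ = _
  rw [expo_eq_prod, Finset.prod_mul_distrib, signOf]
  push_cast
  rw [mul_assoc]
  rfl

lemma denomAlg_eq_altAlg : denomAlg n = altAlg (rho n) := by
  apply IsFractionRing.injective (GroupAlg n) (Frac n)
  rw [algebraMap_denomAlg, algebraMap_altAlg, weylDenom_eq_alternant _ xvar_ne_zero]

lemma laplacian_altAlg (ν : Weight n) :
    laplacian (altAlg ν) = ((ν ⬝ᵥ ν : ℤ) : GroupAlg n) * altAlg ν := by
  simp only [altAlg, map_sum, Finset.mul_sum]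
  refine Finset.sum_congr rfl fun σ _ => Finset.sum_congr rfl fun s _ => ?_
  rw [laplacian, scale_single, signedPerm_dotProduct_self, intCast_def, single_mul_single, zero_add]

/-- An alternant is an eigenvector of the Laplacian, so its exponents have a fixed norm. -/
lemma coeff_altAlg_eq_zero {ν ν' : Weight n} (h : ν' ⬝ᵥ ν' ≠ ν ⬝ᵥ ν) :
    (altAlg ν).coeff ν' = 0 := by
  have h1 := congrArg (fun f : GroupAlg n => f.coeff ν') (laplacian_altAlg ν)
  simp only [laplacian, coeff_scale, intCast_def, coeff_single_mul_apply, neg_zero, zero_add] at h1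
  have h2 : ((ν' ⬝ᵥ ν' : ℤ) : K) - ((ν ⬝ᵥ ν : ℤ) : K) ≠ 0 := by
    rw [sub_ne_zero]; exact_mod_cast h
  refine (mul_eq_zero.1 ?_).resolve_left h2
  rw [sub_mul, h1, sub_self]

lemma coeff_altAlg_self {ν : Weight n} (hanti : StrictAnti ν) (hpos : ∀ i, 0 < ν i) :
    (altAlg ν).coeff ν = 1 := by
  have huniq : ∀ σ s, signedPerm σ s ν = ν → σ = 1 ∧ s = 1 := by
    intro σ s h
    have hs : s = 1 := by
      ext i
      have hi := congrFun h i
      rw [signedPerm_apply] at hi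
      rcases Int.units_eq_one_or (s i) with h1 | h1
      · rw [h1]; rfl
      · rw [h1] at hi
        have := hpos i
        have := hpos (σ i)
        simp at hi
        lia
    refine ⟨?_, hs⟩
    ext i
    have hi := congrFun h i
    rw [signedPerm_apply, hs] at hi
    have hσ : σ i = i := hanti.injective (by simpa using hi)
    rw [hσ, Equiv.Perm.one_apply]
  rw [altAlg, coeff_sum, Finsupp.finsetSum_apply, Finset.sum_eq_single 1, coeff_sum,
    Finsupp.finsetSum_apply, Finset.sum_eq_single 1]
  · have : signedPerm 1 1 ν = ν := by ext i; simp [signedPerm_apply]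
    rw [this, coeff_single]
    simp [signOf]
  · intro s _ hs
    rw [coeff_single, Finsupp.single_apply, if_neg fun h => hs (huniq _ _ h).2]
  · simp
  · intro σ _ hσ
    rw [coeff_sum, Finsupp.finsetSum_apply]
    refine Finset.sum_eq_zero fun s _ => ?_
    rw [coeff_single, Finsupp.single_apply, if_neg fun h => hσ (huniq _ _ h).1]
  · simp

lemma rho_strictAnti : StrictAnti (rho n) := by
  intro i j hij
  have : (i : ℕ) < j := hij
  simp only [rho]; lia

lemma rho_pos (i : Fin n) : 0 < rho n i := by
  have := i.2
  simp only [rho]; lia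

variable {V : Type} [AddCommGroup V] [Module ℂ V] [LieRingModule (Sp n) V]
  [LieModule ℂ (Sp n) V] [FiniteDimensional ℂ V]

lemma mult_signedPerm (σ : Equiv.Perm (Fin n)) (s : Fin n → ℤˣ) (μ : Weight n) :
    mult V (signedPerm σ s μ) = mult V μ :=
  (mult_units_mul s (μ ∘ σ)).trans (mult_comp_perm σ μ)

-- For each `w`, rewrite the character by invariance as `∑ mult(μ) e^{wμ}` and use `wρ + wμ = w(μ +
-- ρ)`.
variable (V) in
lemma denomAlg_mul_charAlg :
    denomAlg n * charAlg V = ∑ μ ∈ weights V, (mult V μ : GroupAlg n) * altAlg (μ + rho n) := by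
  have hch : ∀ σ s, charAlg (n := n) V =
      ∑ μ ∈ weights V, single (signedPerm σ s μ) (mult V μ : K) := by
    intro σ s
    rw [charAlg, weightSum]
    symm
    refine Finset.sum_equiv (signedPerm σ s) (fun μ => ?_) (fun μ _ => ?_)
    · rw [mem_weights, mem_weights, mult_signedPerm]
    · rw [mult_signedPerm]
  simp only [denomAlg_eq_altAlg, altAlg, Finset.mul_sum, Finset.sum_mul]
  rw [Finset.sum_comm (s := weights V)]
  refine Finset.sum_congr rfl fun σ _ => ?_
  rw [Finset.sum_comm (s := weights V)]
  refine Finset.sum_congr rfl fun s _ => ?_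
  rw [hch σ s, Finset.mul_sum]
  refine Finset.sum_congr rfl fun μ _ => ?_
  rw [single_mul_single, natCast_def, single_mul_single, zero_add, signedPerm_add, add_comm,
    mul_comm]

variable [LieModule.IsIrreducible ℂ (Sp n) V]

/-- Let `μ'` be the dominant conjugate of `μ`. Then `(μ, μ) = (μ', μ') ≤ (λ, μ') ≤ (λ, λ)`, while
the pairing with `ρ` is strictly smaller. -/
lemma dotProduct_add_rho_lt {lam : Weight n} {v : V} (hv : IsHighestWeightVector V lam v)
    (hlam : IsDominant lam) {μ : Weight n} (hμ : mult V μ ≠ 0) (hne : μ ≠ lam) :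
    (μ + rho n) ⬝ᵥ (μ + rho n) < (lam + rho n) ⬝ᵥ (lam + rho n) := by
  obtain ⟨σ, s, hdom⟩ := exists_signedPerm_isDominant μ
  set μ' := signedPerm σ s μ with hμ'
  have hle : ∀ t, IsDominant t → μ' ⬝ᵥ t ≤ lam ⬝ᵥ t := by
    intro t ht
    by_cases h : μ' = lam
    · rw [h]
    · exact (isBelow_of_mult_ne_zero hv (by rwa [hμ', mult_signedPerm]) h).1 t ht
  have h1 : μ ⬝ᵥ μ ≤ lam ⬝ᵥ lam := by
    rw [← signedPerm_dotProduct_self σ s μ]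
    calc μ' ⬝ᵥ μ' ≤ lam ⬝ᵥ μ' := hle _ hdom
      _ = μ' ⬝ᵥ lam := dotProduct_comm _ _
      _ ≤ lam ⬝ᵥ lam := hle _ hlam
  have h2 := (isBelow_of_mult_ne_zero hv hμ hne).2
  simp only [add_dotProduct, dotProduct_add, dotProduct_comm (rho n) _]
  linarith

/-- The Weyl character formula of type `C_n`, in the group algebra. -/
theorem denomAlg_mul_charAlg_eq {lam : Weight n} {v : V} (hv : IsHighestWeightVector V lam v)
    (hlam : IsDominant lam) : denomAlg n * charAlg V = altAlg (lam + rho n) := by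
  obtain ⟨c, hc⟩ := exists_casimir_eq_smul (n := n) V
  have hlap := laplacian_denomAlg_mul_charAlg V hc (r := rho n ⬝ᵥ rho n)
    (by rw [denomAlg_eq_altAlg, laplacian_altAlg])
  set y := denomAlg n * charAlg V with hy
  set c' : K := algebraMap ℂ K c + 2 * ((rho n ⬝ᵥ rho n : ℤ) : K) with hc'
  have hcoeff : ∀ ν : Weight n, 2 * ((ν ⬝ᵥ ν : ℤ) : K) * y.coeff ν = c' * y.coeff ν := by
    intro ν
    have h := congrArg (fun f : GroupAlg n => f.coeff ν) hlap
    simp only [two_mul, coeff_add, Finsupp.add_apply] at h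
    rw [← Algebra.smul_def, coeff_smul_apply, smul_eq_mul, laplacian, coeff_scale] at h
    rw [← h]; ring
  -- On the sphere through `λ + ρ` every other `A(μ + ρ)` vanishes, being supported on a smaller
  -- sphere.
  have htop : ∀ ν : Weight n, ν ⬝ᵥ ν = (lam + rho n) ⬝ᵥ (lam + rho n) →
      y.coeff ν = (altAlg (lam + rho n)).coeff ν := by
    intro ν hν
    rw [hy, denomAlg_mul_charAlg, coeff_sum, Finsupp.finsetSum_apply, Finset.sum_eq_single lam]
    · rw [mult_highestWeight hv, Nat.cast_one, one_mul]
    · intro μ hμ hne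
      have := dotProduct_add_rho_lt hv hlam ((mem_weights V).1 hμ) hne
      rw [natCast_def, coeff_single_mul_apply, neg_zero, zero_add,
        coeff_altAlg_eq_zero (by rw [hν]; exact this.ne'), mul_zero]
    · intro h
      rw [mem_weights, not_not, mult_highestWeight hv] at h
      exact absurd h one_ne_zero
  have hone : y.coeff (lam + rho n) = 1 := by
    rw [htop _ rfl, coeff_altAlg_self]
    · intro i j hij
      exact add_lt_add_of_le_of_lt (hlam.1 hij.le) (rho_strictAnti hij)
    · intro i
      exact add_pos_of_nonneg_of_pos (hlam.2 i) (rho_pos i)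
  -- The eigenvalue is read off from the coefficient `1` at `λ + ρ`, so the scalar `c` by which the
  -- Casimir operator acts is never computed.
  have hceq : c' = 2 * (((lam + rho n) ⬝ᵥ (lam + rho n) : ℤ) : K) := by
    have := hcoeff (lam + rho n)
    rw [hone, mul_one, mul_one] at this
    exact this.symm
  ext ν
  by_cases hν : ν ⬝ᵥ ν = (lam + rho n) ⬝ᵥ (lam + rho n)
  · exact htop ν hν
  · rw [coeff_altAlg_eq_zero hν]
    have h1 := hcoeff ν
    rw [hceq, ← sub_eq_zero, ← sub_mul, ← mul_sub] at h1
    refine (mul_eq_zero.1 h1).resolve_left (mul_ne_zero two_ne_zero ?_)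
    rw [sub_ne_zero]
    exact_mod_cast hν

/-- The Weyl character formula of type `C_n`. -/
theorem weylDenom_mul_character {lam : Weight n} {v : V} (hv : IsHighestWeightVector V lam v)
    (hlam : IsDominant lam) :
    weylDenom (xvar n) * character (n := n) V = alternant (xvar n) (lam + rho n) := by
  rw [character_eq, ← algebraMap_denomAlg, ← map_mul, denomAlg_mul_charAlg_eq hv hlam,
    algebraMap_altAlg]

end CharacterFormula

/-! ### Existence of simple modules with hook highest weights -/

section SimpleQuotient

variable {n : ℕ} {M M' : Type} [AddCommGroup M] [Module ℂ M] [LieRingModule (Sp n) M]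
  [LieModule ℂ (Sp n) M] [AddCommGroup M'] [Module ℂ M'] [LieRingModule (Sp n) M']
  [LieModule ℂ (Sp n) M']

lemma IsHighestWeightVector.map {lam : Weight n} {v : M} (hv : IsHighestWeightVector M lam v)
    (f : M →ₗ⁅ℂ, Sp n⁆ M') (hf : f v ≠ 0) : IsHighestWeightVector M' lam (f v) := by
  refine ⟨hf, mem_weightSpace.2 fun h => ?_, fun α hα x hx => ?_⟩
  · rw [← LieModuleHom.map_lie, mem_weightSpace.1 hv.2.1, map_smul]
  · rw [← LieModuleHom.map_lie, hv.2.2 α hα x hx, map_zero]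

lemma IsHighestWeightVector.of_map {lam : Weight n} {v : M} (f : M →ₗ⁅ℂ, Sp n⁆ M')
    (hf : Function.Injective f) (hv : IsHighestWeightVector M' lam (f v)) :
    IsHighestWeightVector M lam v := by
  refine ⟨fun h => hv.1 (by rw [h, map_zero]), mem_weightSpace.2 fun h => hf ?_,
    fun α hα x hx => hf ?_⟩
  · rw [LieModuleHom.map_lie, mem_weightSpace.1 hv.2.1, map_smul]
  · rw [LieModuleHom.map_lie, hv.2.2 α hα x hx, map_zero]

/-- A finite-dimensional module with a highest weight vector has a simple subquotient with the
same highest weight. -/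
theorem nonempty_simpleModule [FiniteDimensional ℂ M] {lam : Weight n} {v : M}
    (hv : IsHighestWeightVector M lam v) : Nonempty (SimpleModuleOfHighestWeight n lam) := by
  let N : LieSubmodule ℂ (Sp n) M := LieSubmodule.lieSpan ℂ (Sp n) {v}
  have hvN : v ∈ N := LieSubmodule.subset_lieSpan rfl
  let v' : N := ⟨v, hvN⟩
  have hv' : IsHighestWeightVector N lam v' :=
    IsHighestWeightVector.of_map N.incl N.injective_incl hv
  -- `N` is generated by `v'`, so a maximal submodule of `N` cannot contain `v'`, and its image in
  -- the quotient is nonzero.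
  have hgen : ∀ T : LieSubmodule ℂ (Sp n) N, v' ∈ T → T = ⊤ := by
    intro T hT
    have hle : N ≤ T.map N.incl := by
      refine LieSubmodule.lieSpan_le.2 (Set.singleton_subset_iff.2 ?_)
      exact LieSubmodule.mem_map_of_mem (f := N.incl) hT
    refine eq_top_iff.2 fun w _ => ?_
    obtain ⟨u, hu, huw⟩ := (LieSubmodule.mem_map _).1 (hle w.2)
    have : u = w := N.injective_incl huw
    rwa [← this]
  have hbot : (⊥ : LieSubmodule ℂ (Sp n) N) ≠ ⊤ := by
    intro h
    have : v' ∈ (⊥ : LieSubmodule ℂ (Sp n) N) := by rw [h]; trivial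
    exact hv'.1 (by simpa using this)
  obtain ⟨T, hT, -⟩ := (eq_top_or_exists_le_coatom (⊥ : LieSubmodule ℂ (Sp n) N)).resolve_left hbot
  have hvT : v' ∉ T := fun h => hT.1 (hgen T h)
  have hne : LieSubmodule.Quotient.mk' T v' ≠ 0 := by
    intro h
    exact hvT ((LieSubmodule.Quotient.mk_eq_zero' (N := T)).1 h)
  have hmk : ∀ w, w ∈ T → LieSubmodule.Quotient.mk' T w = 0 := fun w hw =>
    (LieSubmodule.Quotient.mk_eq_zero' (N := T)).2 hw
  have hirr : LieModule.IsIrreducible ℂ (Sp n) (N ⧸ T) := by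
    have : Nontrivial (N ⧸ T) := ⟨⟨_, _, hne⟩⟩
    refine LieModule.IsIrreducible.mk fun S hS => ?_
    have hle : T ≤ S.comap (LieSubmodule.Quotient.mk' T) := by
      intro w hw
      rw [LieSubmodule.mem_comap, hmk w hw]
      exact zero_mem _
    have hsurj := LieSubmodule.Quotient.surjective_mk' T
    rcases hle.eq_or_lt with h | h
    · exfalso
      apply hS
      refine eq_bot_iff.2 fun w hw => ?_
      obtain ⟨u, rfl⟩ := hsurj w
      have hu : u ∈ S.comap (LieSubmodule.Quotient.mk' T) := hw
      rw [← h] at hu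
      rw [hmk u hu]
      exact zero_mem _
    · have htop := hT.2 _ h
      refine eq_top_iff.2 fun w _ => ?_
      obtain ⟨u, rfl⟩ := hsurj w
      have hu : u ∈ S.comap (LieSubmodule.Quotient.mk' T) := by rw [htop]; trivial
      exact hu
  exact ⟨{
    carrier := N ⧸ T
    finiteDimensional := inferInstanceAs (FiniteDimensional ℂ (N.toSubmodule ⧸ T.toSubmodule))
    irreducible := hirr
    exists_highestWeightVector := ⟨_, hv'.map (LieSubmodule.Quotient.mk' T) hne⟩ }⟩

end SimpleQuotient

/-! ### Highest weight vectors in polynomial modules -/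

section PolynomialModule

open MvPolynomial

variable {n : ℕ}

/-- The polynomial functions on `n`-tuples of covectors. -/
abbrev Poly (n : ℕ) : Type := MvPolynomial ((Fin n ⊕ Fin n) × Fin n) ℂ

/-- The action of a matrix on polynomials, as a derivation. -/
def polyDeriv (x : Matrix (Fin n ⊕ Fin n) (Fin n ⊕ Fin n) ℂ) : Derivation ℂ (Poly n) (Poly n) :=
  mkDerivation ℂ fun p => ∑ b, C (x b p.1) * X (b, p.2)

lemma polyDeriv_X (x : Matrix (Fin n ⊕ Fin n) (Fin n ⊕ Fin n) ℂ) (a : Fin n ⊕ Fin n) (j : Fin n) :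
    polyDeriv x (X (a, j)) = ∑ b, C (x b a) * X (b, j) := mkDerivation_X _ _ _

lemma polyDeriv_add (x y : Matrix (Fin n ⊕ Fin n) (Fin n ⊕ Fin n) ℂ) :
    polyDeriv (x + y) = polyDeriv x + polyDeriv y := by
  refine derivation_ext fun ⟨a, j⟩ => ?_
  simp only [Derivation.add_apply, polyDeriv_X, Matrix.add_apply, map_add, add_mul,
    Finset.sum_add_distrib]

lemma polyDeriv_smul (c : ℂ) (x : Matrix (Fin n ⊕ Fin n) (Fin n ⊕ Fin n) ℂ) :
    polyDeriv (c • x) = c • polyDeriv x := by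
  refine derivation_ext fun ⟨a, j⟩ => ?_
  simp only [Derivation.smul_apply, polyDeriv_X, Matrix.smul_apply, smul_eq_mul, map_mul,
    Finset.smul_sum, smul_eq_C_mul, mul_assoc]

lemma polyDeriv_lie (x y : Matrix (Fin n ⊕ Fin n) (Fin n ⊕ Fin n) ℂ) :
    polyDeriv (x * y - y * x) = ⁅polyDeriv x, polyDeriv y⁆ := by
  have h : ∀ (x y : Matrix (Fin n ⊕ Fin n) (Fin n ⊕ Fin n) ℂ) (a : Fin n ⊕ Fin n) (j : Fin n),
      polyDeriv x (polyDeriv y (X (a, j))) = ∑ c, C ((x * y) c a) * X (c, j) := by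
    intro x y a j
    simp only [polyDeriv_X, map_sum, Derivation.leibniz, Matrix.mul_apply, Finset.sum_mul,
      ← algebraMap_eq, Derivation.map_algebraMap, smul_eq_mul, mul_zero, add_zero, Finset.mul_sum]
    rw [Finset.sum_comm]
    refine Finset.sum_congr rfl fun c _ => Finset.sum_congr rfl fun b _ => ?_
    rw [map_mul]; ring
  refine derivation_ext fun ⟨a, j⟩ => ?_
  rw [Derivation.commutator_apply, h, h, polyDeriv_X, ← Finset.sum_sub_distrib]
  refine Finset.sum_congr rfl fun c _ => ?_
  rw [Matrix.sub_apply, map_sub, sub_mul]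

instance : LieRingModule (Sp n) (Poly n) where
  bracket x f := polyDeriv x.1 f
  add_lie x y f := by
    change polyDeriv (x.1 + y.1) f = _
    rw [polyDeriv_add]; rfl
  lie_add x f g := map_add _ f g
  leibniz_lie x y f := by
    change polyDeriv x.1 (polyDeriv y.1 f) =
      polyDeriv (x.1 * y.1 - y.1 * x.1) f + polyDeriv y.1 (polyDeriv x.1 f)
    rw [polyDeriv_lie, Derivation.commutator_apply]
    abel

instance : LieModule ℂ (Sp n) (Poly n) where
  smul_lie c x f := by
    change polyDeriv (c • x.1) f = _
    rw [polyDeriv_smul]; rfl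
  lie_smul c x f := (polyDeriv x.1).map_smul c f

lemma poly_lie (x : Sp n) (f : Poly n) : ⁅x, f⁆ = polyDeriv x.1 f := rfl

/-- The space of linear forms. -/
def linForms (n : ℕ) : Submodule ℂ (Poly n) := Submodule.span ℂ (Set.range X)

lemma polyDeriv_linForms (x : Matrix (Fin n ⊕ Fin n) (Fin n ⊕ Fin n) ℂ) {f : Poly n}
    (hf : f ∈ linForms n) : polyDeriv x f ∈ linForms n := by
  have : linForms n ≤ (linForms n).comap (polyDeriv x : Poly n →ₗ[ℂ] Poly n) := by
    refine Submodule.span_le.2 ?_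
    rintro _ ⟨⟨a, j⟩, rfl⟩
    change polyDeriv x (X (a, j)) ∈ linForms n
    rw [polyDeriv_X]
    refine Submodule.sum_mem _ fun b _ => ?_
    rw [← smul_eq_C_mul]
    exact Submodule.smul_mem _ _ (Submodule.subset_span ⟨_, rfl⟩)
  exact this hf

/-- The module of homogeneous polynomials of degree `d`. -/
def homogPoly (n d : ℕ) : LieSubmodule ℂ (Sp n) (Poly n) where
  __ := linForms n ^ d
  lie_mem := by
    intro x f hf
    change f ∈ linForms n ^ d at hf
    change polyDeriv x.1 f ∈ linForms n ^ d
    induction d generalizing f with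
    | zero =>
      rw [pow_zero, Submodule.mem_one] at hf
      obtain ⟨c, rfl⟩ := hf
      rw [Derivation.map_algebraMap]
      exact zero_mem _
    | succ d ih =>
      rw [pow_succ] at hf ⊢
      induction hf using Submodule.mul_induction_on' with
      | mem_mul_mem f hf g hg =>
        rw [Derivation.leibniz, smul_eq_mul, smul_eq_mul, mul_comm g]
        exact add_mem (Submodule.mul_mem_mul hf (polyDeriv_linForms _ hg))
          (Submodule.mul_mem_mul (ih hf) hg)
      | add f _ g _ hf hg => rw [map_add]; exact add_mem hf hg

instance (d : ℕ) : FiniteDimensional ℂ (homogPoly n d) := by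
  have h : (linForms n).FG := Submodule.fg_span (Set.finite_range X)
  exact Module.Finite.iff_fg.2 (h.pow d)

lemma prod_mem_linForms_pow {ι : Type*} (S : Finset ι) (f : ι → Poly n)
    (hf : ∀ i ∈ S, f i ∈ linForms n) : ∏ i ∈ S, f i ∈ linForms n ^ S.card := by
  classical
  induction S using Finset.induction_on with
  | empty => simpa [Submodule.mem_one] using ⟨1, C_1⟩
  | insert i S hi ih =>
    rw [Finset.prod_insert hi, Finset.card_insert_of_notMem hi, pow_succ, mul_comm (f i)]
    exact Submodule.mul_mem_mul (ih fun j hj => hf j (Finset.mem_insert_of_mem hj))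
      (hf i (Finset.mem_insert_self i S))

lemma derivation_prod {R A ι : Type*} [CommRing R] [CommRing A] [Algebra R A] [DecidableEq ι]
    (D : Derivation R A A) (S : Finset ι) (f : ι → A) :
    D (∏ i ∈ S, f i) = ∑ i ∈ S, D (f i) * ∏ j ∈ S.erase i, f j := by
  induction S using Finset.induction_on with
  | empty => simp
  | insert i S hi ih =>
    rw [Finset.prod_insert hi, Derivation.leibniz, ih, Finset.sum_insert hi,
      Finset.erase_insert hi, smul_eq_mul, smul_eq_mul, Finset.mul_sum, add_comm, mul_comm (D (f i))]
    congr 1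
    refine Finset.sum_congr rfl fun j hj => ?_
    have hij : i ≠ j := fun h => hi (h ▸ hj)
    rw [Finset.erase_insert_of_ne hij, Finset.prod_insert (by simp [hi])]
    ring

lemma derivation_det {R A m : Type*} [CommRing R] [CommRing A] [Algebra R A] [DecidableEq m]
    [Fintype m] (D : Derivation R A A) (B : Matrix m m A) :
    D B.det = ∑ i, (B.updateCol i fun r => D (B r i)).det := by
  simp only [Matrix.det_apply', map_sum]
  rw [Finset.sum_comm]
  refine Finset.sum_congr rfl fun σ _ => ?_
  rw [Derivation.leibniz, Derivation.map_intCast, smul_zero, add_zero, derivation_prod, smul_eq_mul,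
    Finset.mul_sum]
  refine Finset.sum_congr rfl fun i _ => ?_
  rw [← Finset.mul_prod_erase Finset.univ (fun j => B.updateCol i _ (σ j) j) (Finset.mem_univ i),
    Matrix.updateCol_self]
  congr 2
  exact Finset.prod_congr rfl fun j hj => by rw [Matrix.updateCol_ne (Finset.ne_of_mem_erase hj)]

variable {p : ℕ} (hp : p ≤ n)

/-- The generic minor in the first `p` basis vectors. -/
def minorMatrix : Matrix (Fin p) (Fin p) (Poly n) :=
  Matrix.of fun r i => X (.inl (Fin.castLE hp i), Fin.castLE hp r)

lemma minorMatrix_det_mem : (minorMatrix hp).det ∈ linForms n ^ p := by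
  rw [Matrix.det_apply]
  refine Submodule.sum_mem _ fun σ _ => ?_
  have h := prod_mem_linForms_pow Finset.univ (fun i => minorMatrix hp (σ i) i)
    (fun i _ => Submodule.subset_span ⟨_, rfl⟩)
  rw [Finset.card_univ, Fintype.card_fin] at h
  rcases Int.units_eq_one_or (Equiv.Perm.sign σ) with hs | hs
  · rw [hs, one_smul]; exact h
  · rw [hs, Units.neg_smul, one_smul]; exact neg_mem h

lemma polyDeriv_cartan_X (h : Fin n → ℂ) (i j : Fin n) :
    polyDeriv (cartan h).1 (X (.inl i, j)) = h i • X (.inl i, j) := by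
  rw [polyDeriv_X, cartan_val, Finset.sum_eq_single (.inl i)]
  · rw [Matrix.diagonal_apply_eq, smul_eq_C_mul]; rfl
  · intro b _ hb; rw [Matrix.diagonal_apply_ne _ hb, map_zero, zero_mul]
  · simp

lemma wt_eq_of_rootVector {α : Weight n} {x : Sp n}
    (hx : ∀ h : Fin n → ℂ, ⁅cartan h, x⁆ = evalWeight α h • x) {a b : Fin n ⊕ Fin n}
    (hab : x.1 a b ≠ 0) : wt a - wt b = α := by
  apply evalWeight_injective
  ext h
  have h1 := congrArg (fun y : Sp n => y.1 a b) (hx h)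
  simp only [LieSubalgebra.coe_bracket, Ring.lie_def, cartan_val, Matrix.sub_apply,
    Matrix.diagonal_mul, Matrix.mul_diagonal] at h1
  have h2 : ((evalWeight α h) • x).1 a b = evalWeight α h * x.1 a b := rfl
  rw [h2, ← evalWeight_wt, ← evalWeight_wt, mul_comm _ (evalWeight (wt b) h), ← sub_mul,
    ← evalWeight_sub] at h1
  exact mul_right_cancel₀ hab h1

lemma wt_injective : Function.Injective (wt (n := n)) := fun _ _ h =>
  expo_wt_injective (congrArg expo h)

/-- A positive root vector moves a basis vector to one whose weight pairs more strictly with `rho`.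
From weight `ε_i` this leaves only `ε_l` with `l < i`, and `wt_injective` leaves only one `l`. -/
lemma polyDeriv_positive_X {α : Weight n} (hα : α ∈ positiveRoots n) {x : Sp n}
    (hx : ∀ h : Fin n → ℂ, ⁅cartan h, x⁆ = evalWeight α h • x) (i : Fin n) :
    (∀ j, polyDeriv x.1 (X (.inl i, j)) = 0) ∨
      ∃ l < i, ∃ c : ℂ, ∀ j, polyDeriv x.1 (X (.inl i, j)) = C c * X (.inl l, j) := by
  by_cases h : ∀ b, x.1 b (.inl i) = 0
  · left
    intro j
    rw [polyDeriv_X]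
    exact Finset.sum_eq_zero fun b _ => by rw [h, map_zero, zero_mul]
  · right
    push Not at h
    obtain ⟨b, hb⟩ := h
    have hw := wt_eq_of_rootVector hx hb
    have hpos := dotProduct_rho_pos hα
    rw [← hw, sub_dotProduct] at hpos
    rcases b with l | l
    · refine ⟨l, ?_, x.1 (.inl l) (.inl i), fun j => ?_⟩
      · simpa [wt, eps, rho] using hpos
      · rw [polyDeriv_X, Finset.sum_eq_single (.inl l)]
        · intro b' _ hb'
          by_cases h0 : x.1 b' (.inl i) = 0
          · rw [h0, map_zero, zero_mul]
          · exact absurd (wt_injective (sub_left_injective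
              ((wt_eq_of_rootVector hx h0).trans hw.symm))) hb'
        · simp
    · exfalso
      have h1 := rho_pos (n := n) l
      have h2 := rho_pos (n := n) i
      simp [wt, eps] at hpos
      lia

lemma polyDeriv_cartan_minor (h : Fin n → ℂ) :
    polyDeriv (cartan h).1 (minorMatrix hp).det =
      (∑ i : Fin p, h (Fin.castLE hp i)) • (minorMatrix hp).det := by
  rw [derivation_det, Finset.sum_smul]
  refine Finset.sum_congr rfl fun i _ => ?_
  have : (fun r => polyDeriv (cartan h).1 (minorMatrix hp r i)) =
      (C (h (Fin.castLE hp i)) : Poly n) • fun r => minorMatrix hp r i := by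
    ext1 r
    rw [minorMatrix, Matrix.of_apply, polyDeriv_cartan_X, smul_eq_C_mul]; rfl
  rw [this, Matrix.det_updateCol_smul, Matrix.updateCol_eq_self, smul_eq_C_mul]

/-- The derivative of each column is zero or a multiple of an earlier column of the same minor,
since the minor uses an initial segment of basis vectors. -/
lemma polyDeriv_positive_minor {α : Weight n} (hα : α ∈ positiveRoots n) {x : Sp n}
    (hx : ∀ h : Fin n → ℂ, ⁅cartan h, x⁆ = evalWeight α h • x) :
    polyDeriv x.1 (minorMatrix hp).det = 0 := by
  rw [derivation_det]
  refine Finset.sum_eq_zero fun i _ => ?_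
  rcases polyDeriv_positive_X hα hx (Fin.castLE hp i) with h | ⟨l, hl, c, h⟩
  · refine Matrix.det_eq_zero_of_column_eq_zero i fun r => ?_
    rw [Matrix.updateCol_self]
    exact h _
  · have hl' : (l : ℕ) < i := hl
    let l' : Fin p := ⟨l, by have := i.2; lia⟩
    have hne : i ≠ l' := by
      intro hil; have := congrArg Fin.val hil; simp [l'] at this; lia
    have : (fun r => polyDeriv x.1 (minorMatrix hp r i)) =
        (C c : Poly n) • fun r => minorMatrix hp r l' := by
      ext1 r
      rw [minorMatrix, Matrix.of_apply, h]; rfl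
    rw [this, Matrix.det_updateCol_smul, Matrix.det_zero_of_column_eq hne, mul_zero]
    intro r
    rw [Matrix.updateCol_self, Matrix.updateCol_ne hne.symm]

/-- Evaluate at the point where the generic matrix becomes the identity. -/
lemma minorMatrix_det_ne_zero : (minorMatrix hp).det ≠ 0 := by
  intro h
  have h1 := congrArg (eval fun q : (Fin n ⊕ Fin n) × Fin n => if q.1 = .inl q.2 then (1 : ℂ) else 0) h
  rw [RingHom.map_det, map_zero] at h1
  have : (eval fun q : (Fin n ⊕ Fin n) × Fin n => if q.1 = .inl q.2 then (1 : ℂ) else 0).mapMatrix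
      (minorMatrix hp) = 1 := by
    ext r i
    simp [minorMatrix, Matrix.one_apply, eq_comm]
  rw [this, Matrix.det_one] at h1
  exact one_ne_zero h1

/-- Simple modules with hook highest weights exist. -/
theorem nonempty_simpleModule_hookWeight (hn : 1 ≤ n) {k r : ℕ} (hrk : r < k) :
    Nonempty (SimpleModuleOfHighestWeight n (hookWeight n k r)) := by
  have hp : rbar n r + 1 ≤ n := by simp only [rbar]; lia
  let m := k - r - 1
  let z : Fin n := ⟨0, hn⟩
  -- The minor has weight `ε_1 + ⋯ + ε_{r̄+1}`; the `m = k - r - 1` further factors of weight `ε_1`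
  -- bring the first coordinate to `k - r`. Restricting to homogeneous polynomials makes the module
  -- finite-dimensional.
  let v : Poly n := X (.inl z, z) ^ m * (minorMatrix hp).det
  have hvmem : v ∈ homogPoly n (m + (rbar n r + 1)) := by
    change v ∈ linForms n ^ (m + (rbar n r + 1))
    rw [pow_add]
    refine Submodule.mul_mem_mul (Submodule.pow_mem_pow _ (Submodule.subset_span (Set.mem_range_self _)) m)
      (minorMatrix_det_mem hp)
  have hv0 : v ≠ 0 := mul_ne_zero (pow_ne_zero _ (X_ne_zero _)) (minorMatrix_det_ne_zero hp)
  have hv : IsHighestWeightVector (Poly n) (hookWeight n k r) v := by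
    refine ⟨hv0, mem_weightSpace.2 fun h => ?_, fun α hα x hx => ?_⟩
    · rw [poly_lie, Derivation.leibniz, Derivation.leibniz_pow, polyDeriv_cartan_minor,
        polyDeriv_cartan_X]
      have hw : evalWeight (hookWeight n k r) h =
          m * h z + ∑ i : Fin (rbar n r + 1), h (Fin.castLE hp i) := by
        have hfilter : ∑ i : Fin (rbar n r + 1), h (Fin.castLE hp i) =
            ∑ i : Fin n, if (i : ℕ) ≤ rbar n r then h i else 0 := by
          rw [← Finset.sum_filter]
          have hset : Finset.univ.filter (fun i : Fin n => (i : ℕ) ≤ rbar n r) =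
              Finset.univ.map (Fin.castLEEmb hp) := by
            ext i
            simp only [Finset.mem_filter, Finset.mem_univ, true_and, Finset.mem_map]
            exact ⟨fun hi => ⟨⟨i, by lia⟩, rfl⟩, fun ⟨j, hj⟩ => hj ▸ Nat.le_of_lt_succ j.2⟩
          rw [hset, Finset.sum_map]; rfl
        have hz : (m : ℂ) * h z = ∑ i : Fin n, if i = z then (m : ℂ) * h i else 0 := by simp
        rw [hfilter, hz, ← Finset.sum_add_distrib, evalWeight]
        refine Finset.sum_congr rfl fun i _ => ?_
        have hiz : i = z ↔ (i : ℕ) = 0 := Fin.ext_iff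
        have hm : ((k : ℤ) - r) = m + 1 := by simp only [m]; lia
        simp only [hookWeight, hiz, hm]
        split_ifs <;> first | lia | (push_cast; ring)
      rw [hw]
      simp only [v, smul_eq_mul, nsmul_eq_mul, smul_eq_C_mul, map_add, map_mul, map_natCast]
      rcases m with _ | m
      · simp
      · rw [Nat.add_sub_cancel, pow_succ]; ring
    · rw [poly_lie, Derivation.leibniz, Derivation.leibniz_pow, polyDeriv_positive_minor hp hα hx]
      have : polyDeriv x.1 (X (.inl z, z)) = 0 := by
        rcases polyDeriv_positive_X hα hx z with h | ⟨l, hl, -⟩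
        · exact h z
        · exact absurd hl (Nat.not_lt_zero _)
      rw [this]
      simp
  let v' : homogPoly n (m + (rbar n r + 1)) := ⟨v, hvmem⟩
  exact nonempty_simpleModule (v := v')
    (IsHighestWeightVector.of_map (homogPoly n _).incl (homogPoly n _).injective_incl hv)

end PolynomialModule

/-! ### The expansion of `G_{n,k}` into characters -/

section Expansion

variable {n : ℕ}

lemma isDominant_hookWeight {k r : ℕ} (hrk : r < k) : IsDominant (hookWeight n k r) := by
  refine ⟨fun i j hij => ?_, fun i => ?_⟩
  · have : (i : ℕ) ≤ j := hij
    simp only [hookWeight]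
    split_ifs <;> lia
  · simp only [hookWeight]
    split_ifs <;> lia

lemma weylDenom_mul_chi (hn : 1 ≤ n) {k r : ℕ} (hrk : r < k) :
    weylDenom (xvar n) * chi (hookWeight n k r) =
      alternant (xvar n) (hookWeight n k r + rho n) := by
  have h := nonempty_simpleModule_hookWeight hn hrk
  rw [chi, dif_pos h]
  have := h.some.finiteDimensional
  have := h.some.irreducible
  obtain ⟨v, hv⟩ := h.some.exists_highestWeightVector
  exact weylDenom_mul_character hv (isDominant_hookWeight hrk)

lemma q_ne_zero : q n ≠ 0 := by
  rw [q, Ne, ← map_zero (algebraMap (GroupAlg n) (Frac n)),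
    (IsFractionRing.injective (GroupAlg n) (Frac n)).eq_iff,
    ← map_zero (algebraMap K (GroupAlg n)),
    (FaithfulSMul.algebraMap_injective K (GroupAlg n)).eq_iff]
  exact RatFunc.X_ne_zero

lemma weylDenom_mul_ChG (k : ℕ) :
    weylDenom (xvar n) * ChG n k =
      ∑ j, (q n ^ (2 * rho n j) *
          alternant (xvar n) (Function.update (rho n) j (rho n j + k)) +
        q n ^ (-(2 * rho n j)) *
          alternant (xvar n) (Function.update (rho n) j (rho n j - k))) := by
  rw [← weylDenom_mul_G (xvar n) xvar_ne_zero weylDenom_xvar_ne_zero (q n) q_ne_zero k, ChG]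
  congr 2
  funext a
  rw [epsIdx, expo_zsmul]
  rfl

lemma sum_Icc_eq_sum_fin {M : Type*} [AddCommMonoid M] (f : ℕ → M) :
    ∑ r ∈ Finset.Icc (n + 1) (2 * n), f r = ∑ j : Fin n, f (2 * n - j) := by
  symm
  refine Finset.sum_bij (fun j _ => 2 * n - j) (fun j _ => ?_) (fun i _ j _ h => ?_)
    (fun r hr => ?_) (fun _ _ => rfl)
  · have := j.2
    rw [Finset.mem_Icc]; lia
  · have := i.2
    have := j.2
    ext; lia
  · rw [Finset.mem_Icc] at hr
    exact ⟨⟨2 * n - r, by lia⟩, Finset.mem_univ _, by simp only; lia⟩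

lemma weylDenom_mul_hookTerm_left (hn : 1 ≤ n) {k : ℕ} (hk : 1 ≤ k) (j : Fin n) :
    q n ^ (2 * rho n j) * alternant (xvar n) (Function.update (rho n) j (rho n j + k)) =
      weylDenom (xvar n) * if (j : ℕ) < k then hookTerm n k j else 0 := by
  split_ifs with h
  · rw [alternant_rho_add_of_lt, ← weylDenom_mul_chi hn h, hookTerm, tau, if_pos j.2, rho, mul_sub]
    push_cast; ring
  · rw [alternant_rho_add_of_le _ _ _ hk (not_lt.1 h), mul_zero, mul_zero]

/-- The index `j` corresponds to `r = 2n - j`, where `τ_r = -1` accounts for the sign in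
`alternant_rho_sub_hook`. If `k = 2 * (n - j)` then `k ≤ 2n - j`, so the two conditional terms
exclude each other. -/
lemma weylDenom_mul_hookTerm_right (hn : 1 ≤ n) {k : ℕ} (hk : 1 ≤ k) (j : Fin n) :
    q n ^ (-(2 * rho n j)) * alternant (xvar n) (Function.update (rho n) j (rho n j - k)) =
      weylDenom (xvar n) * ((if 2 * n - j < k then hookTerm n k (2 * n - j) else 0) +
        if k = 2 * (n - j) then -q n ^ (-(k : ℤ)) else 0) := by
  have hj := j.2
  by_cases h : 2 * n - j < k
  · rw [if_pos h, if_neg (by lia), add_zero, alternant_rho_sub_hook, ← weylDenom_mul_chi hn h,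
      hookTerm, tau, if_neg (by lia), if_neg (by lia)]
    have h1 : 2 * (n : ℤ) - 2 * ((2 * n - j : ℕ) : ℤ) = -(2 * rho n j) := by
      simp only [rho]; lia
    have h2 : (-1 : Frac n) ^ (2 * n - (j : ℕ)) = (-1) ^ (j : ℕ) := by
      have : (-1 : Frac n) ^ (2 * n - (j : ℕ)) * (-1) ^ (2 * (j : ℕ)) =
          (-1) ^ (2 * n) * (-1) ^ (j : ℕ) := by
        rw [← pow_add, ← pow_add]; congr 1; lia
      simpa using this
    rw [h1, h2]
    push_cast; ring
  · rw [if_neg h, zero_add]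
    split_ifs with h'
    · rw [alternant_rho_sub_eq_neg _ _ _ h', ← weylDenom_eq_alternant _ xvar_ne_zero]
      have : -(2 * rho n j) = -(k : ℤ) := by simp only [rho]; lia
      rw [this]; ring
    · rw [alternant_rho_sub_eq_zero _ _ _ hk (not_lt.1 h) h', mul_zero, mul_zero]

theorem ChG_zero :
    ChG n 0 = ∑ r ∈ Finset.range n, q n ^ (2 * (n : ℤ) - 2 * (r : ℤ)) +
      ∑ r ∈ Finset.Icc (n + 1) (2 * n), q n ^ (2 * (n : ℤ) - 2 * (r : ℤ)) := by
  apply mul_left_cancel₀ (weylDenom_xvar_ne_zero (n := n))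
  rw [weylDenom_mul_ChG, sum_Icc_eq_sum_fin, Finset.sum_range, ← Finset.sum_add_distrib,
    Finset.mul_sum]
  refine Finset.sum_congr rfl fun j _ => ?_
  have hj := j.2
  have h1 : 2 * rho n j = 2 * (n : ℤ) - 2 * (j : ℕ) := by simp only [rho]; ring
  have h2 : -(2 * rho n j) = 2 * (n : ℤ) - 2 * ((2 * n - j : ℕ) : ℤ) := by simp only [rho]; lia
  rw [h2, h1, Nat.cast_zero, add_zero, sub_zero, Function.update_eq_self,
    ← weylDenom_eq_alternant _ xvar_ne_zero]
  ring

theorem ChG_of_pos (hn : 1 ≤ n) {k : ℕ} (hk : 1 ≤ k) :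
    ChG n k = (∑ r ∈ Finset.Icc 0 (min (k - 1) (2 * n)), hookTerm n k r) +
      ∑ j : Fin n, if k = 2 * (n - j) then -q n ^ (-(k : ℤ)) else 0 := by
  have hsum : ∑ r ∈ Finset.Icc 0 (min (k - 1) (2 * n)), hookTerm n k r =
      ∑ j : Fin n, ((if (j : ℕ) < k then hookTerm n k j else 0) +
        if 2 * n - j < k then hookTerm n k (2 * n - j) else 0) := by
    have h1 : Finset.Icc 0 (min (k - 1) (2 * n)) =
        (Finset.range (2 * n + 1)).filter (· < k) := by
      ext r; simp only [Finset.mem_Icc, Finset.mem_filter, Finset.mem_range]; lia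
    have h2 : Finset.range (2 * n + 1) =
        insert n (Finset.range n ∪ Finset.Icc (n + 1) (2 * n)) := by
      ext r
      simp only [Finset.mem_insert, Finset.mem_union, Finset.mem_range, Finset.mem_Icc]; lia
    have h3 : Disjoint (Finset.range n) (Finset.Icc (n + 1) (2 * n)) :=
      Finset.disjoint_left.2 fun r h h' => by
        rw [Finset.mem_range] at h; rw [Finset.mem_Icc] at h'; lia
    -- The index `r = n` is matched by no `j`, and there `τ_n = 0`.
    have h4 : hookTerm n k n = 0 := by simp [hookTerm, tau]
    rw [h1, Finset.sum_filter, h2, Finset.sum_insert (by simp), h4, ite_self, zero_add,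
      Finset.sum_union h3, sum_Icc_eq_sum_fin, Finset.sum_range, ← Finset.sum_add_distrib]
  apply mul_left_cancel₀ (weylDenom_xvar_ne_zero (n := n))
  rw [weylDenom_mul_ChG, hsum, ← Finset.sum_add_distrib, Finset.mul_sum]
  refine Finset.sum_congr rfl fun j _ => ?_
  rw [weylDenom_mul_hookTerm_left hn hk, weylDenom_mul_hookTerm_right hn hk]
  ring

end Expansion

end

end TypeC

/-! ### The three cases of the theorem -/

theorem theorem3p6 (n k : ℕ) (hn : 3 ≤ n) :
    (k = 0 →
      TypeC.ChG n k =
        ∑ r ∈ Finset.range n, TypeC.q n ^ (2 * (n : ℤ) - 2 * (r : ℤ)) +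
          ∑ r ∈ Finset.Icc (n + 1) (2 * n), TypeC.q n ^ (2 * (n : ℤ) - 2 * (r : ℤ))) ∧
    (1 ≤ k ∧ k ≤ 2 * n ∧ Even k →
      TypeC.ChG n k =
        -(TypeC.q n ^ (-(k : ℤ))) + ∑ r ∈ Finset.Icc 0 (k - 1), TypeC.hookTerm n k r) ∧
    (1 ≤ k ∧ ¬(k ≤ 2 * n ∧ Even k) →
      TypeC.ChG n k = ∑ r ∈ Finset.Icc 0 (min (k - 1) (2 * n)), TypeC.hookTerm n k r) := by
  refine ⟨?_, ?_, ?_⟩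
  · rintro rfl
    exact TypeC.ChG_zero
  · rintro ⟨hk, hk2, l, rfl⟩
    rw [TypeC.ChG_of_pos (by lia) hk, min_eq_left (by lia), add_comm,
      -- With `k = l + l`, the equation `k = 2 * (n - j)` has the single solution `j = n - l`, a
      -- valid index because `1 ≤ k ≤ 2n`.
      Finset.sum_eq_single (⟨n - l, by lia⟩ : Fin n)]
    · rw [if_pos (by simp only; lia)]
    · intro j _ hj
      refine if_neg fun h => hj (Fin.ext ?_)
      have := j.2
      simp only
      lia
    · simp
  · rintro ⟨hk, hk2⟩
    rw [TypeC.ChG_of_pos (by lia) hk, add_eq_left]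
    refine Finset.sum_eq_zero fun j _ => ?_
    exact if_neg fun h => hk2 ⟨by lia, by rw [h]; exact even_two_mul _⟩
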